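/- Let $n\ge 0$, $m=2n$, let $\mathbb{C}_+$ be the open upper half plane and put $$j_m=\begin{bmatrix} I_n&0\\0&-I_n\end{bmatrix},\quad \mathscr{J}_m=\begin{bmatrix}0&iI_n\\-iI_n&0\end{bmatrix},\quad M=\frac1{\sqrt2}\begin{bmatrix} iI_n&-iI_n\\ I_n&I_n\end{bmatrix},\quad \rho_i(z)=-2\pi i(z+i),\quad f^{\#}(z)=f(\overline z)^*.$$ Matrix valued functions are holomorphic or meromorphic if their entries are, and meromorphic functions on $\mathbb{C}_+$ are identified if they coincide off a set of isolated points of $\mathbb{C}_+$. We use the following classes of $n\times n$ matrix valued functions $f$ holomorphic in $\mathbb{C}_+$: the Carathéodory class $\mathcal{C}^{n\times n}$ ($\frac12(f(z)+f(z)^*)\succeq0$ on $\mathbb{C}_+$); the Schur class $\mathcal{S}^{n\times n}$ (operator norm $\|f(z)\|\le1$ on $\mathbb{C}_+$); the inner functions $\mathcal{S}^{n\times n}_{in}$ (Schur functions with unitary nontangential boundary values a.e. on $\mathbb{R}$); and $H^2_{n\times n}$ ($\sup_{y>0}\int_{\mathbb{R}}\mathrm{trace}\{f(x+iy)^*f(x+iy)\}\,dx<\infty$).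 Let $P(\mathscr{J}_m)$ be the class of $m\times m$ matrix valued functions $\mathcal{A}$ meromorphic in $\mathbb{C}_+$ such that $\mathcal{A}(z)^*\mathscr{J}_m\mathcal{A}(z)\preceq\mathscr{J}_m$ at every $z\in\mathbb{C}_+$ where $\mathcal{A}$ is holomorphic, and let $U(\mathscr{J}_m)$ be the class of $\mathscr{J}_m$-inner functions, that is, those $\mathcal{A}\in P(\mathscr{J}_m)$ that have, at a.e. $x\in\mathbb{R}$, a nontangential boundary value $\mathcal{A}(x)$ with $\mathcal{A}(x)^*\mathscr{J}_m\mathcal{A}(x)=\mathscr{J}_m$. A function $\mathcal{A}\in U(\mathscr{J}_m)$ is continued to the lower half plane $\mathbb{C}_-$ by the symmetry principle $\mathcal{A}(z)=\mathscr{J}_m\{\mathcal{A}^{\#}(z)\}^{-1}\mathscr{J}_m$. Let $\mathcal{A}\in P(\mathscr{J}_m)$ and write $U(z)=\mathcal{A}(z)M=\begin{bmatrix}u_{11}(z)&u_{12}(z)\\u_{21}(z)&u_{22}(z)\end{bmatrix}$ with $n\times n$ blocks. Then: 1. $U(z)^*\mathscr{J}_mU(z)\preceq j_m$ for all $z\in\mathbb{C}_+$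 where $\mathcal{A}$ is holomorphic. 2. $u_{12}(z)$ is invertible for all $z\in\mathbb{C}_+$ where $\mathcal{A}$ is holomorphic. 3. $\Phi=-iu_{22}u_{12}^{-1}\in\mathcal{C}^{n\times n}$ and $\chi=u_{12}^{-1}u_{11}\in\mathcal{S}^{n\times n}$. 4. $\dfrac{u_{12}^{-1}}{\rho_i}\in H^2_{n\times n}$. If moreover $\mathcal{A}\in U(\mathscr{J}_m)$, and $U=\mathcal{A}M$ also on $\mathbb{C}_-$ for the continued $\mathcal{A}$, then $u_{11}^{\#}(z)$ is invertible for all $z\in\mathbb{C}_+$ off a set of isolated points of $\mathbb{C}_+$, and: 5. $\chi=u_{12}^{\#}\{u_{11}^{\#}\}^{-1}$ on $\mathbb{C}_+$, and $\chi\in\mathcal{S}^{n\times n}_{in}$. 6. $\dfrac{-i\{u_{11}^{\#}\}^{-1}}{\rho_i}\in H^2_{n\times n}$. -/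

import Mathlib

open Filter Topology MeasureTheory Matrix
open scoped ComplexOrder

noncomputable section

namespace DeBranges

/-- The open upper half plane `ℂ₊`, as a subset of `ℂ`. -/
def upperPlane : Set ℂ := {z | 0 < z.im}

/-! Matrix valued functions.  A matrix valued function is holomorphic or meromorphic when all its
entries are; a point is a pole when it is a pole of some entry. -/

/-- `A` is holomorphic at the point `z` (that is, on a neighbourhood of `z`). -/
def HolAt {ι κ : Type*} (A : ℂ → Matrix ι κ ℂ) (z : ℂ) : Prop :=
  ∀ i j, AnalyticAt ℂ (fun w => A w i j) z

/-- `A` is holomorphic in the open upper half plane. -/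
def HolUpper {ι κ : Type*} (A : ℂ → Matrix ι κ ℂ) : Prop :=
  ∀ i j, DifferentiableOn ℂ (fun w => A w i j) upperPlane

/-- `A` is meromorphic in the open upper half plane. The values of `A` at its (isolated) singular
points carry no information. -/
def MeroUpper {ι κ : Type*} (A : ℂ → Matrix ι κ ℂ) : Prop :=
  ∀ i j, MeromorphicOn (fun w => A w i j) upperPlane

/-- The open angle with vertex at the real point `x`, symmetric about the vertical line
through `x`. -/
def angle (x α : ℝ) : Set ℂ := {z | 0 < z.im ∧ |z.re - x| < α * z.im}

/-- `L` is the nontangential boundary value of `A` at the real point `x`. The limit is taken through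
points at which `A` is holomorphic. -/
def HasBoundaryValue {ι κ : Type*} (A : ℂ → Matrix ι κ ℂ) (x : ℝ) (L : Matrix ι κ ℂ) : Prop :=
  ∀ α : ℝ, 0 < α → Tendsto A (𝓝[angle x α ∩ {z | HolAt A z}] (x : ℂ)) (𝓝 L)

/-- `f^#(z) = f(z̄)^*`. -/
def sharp {ι κ : Type*} (f : ℂ → Matrix ι κ ℂ) : ℂ → Matrix κ ι ℂ :=
  fun z => (f (starRingEnd ℂ z))ᴴ

/-- `ρ_w(z) = -2πi (z - w̄)`. -/
def rho (w z : ℂ) : ℂ := -2 * (Real.pi : ℂ) * Complex.I * (z - starRingEnd ℂ w)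

/-! Classes of matrix valued functions holomorphic in the upper half plane. -/

/-- The Hardy class `H²`: `f` is holomorphic in `ℂ₊` and
`sup_{y > 0} ∫ trace (f(x+iy)^* f(x+iy)) dx < ∞`. -/
def hardyTwo (n : ℕ) : Set (ℂ → Matrix (Fin n) (Fin n) ℂ) :=
  {f | HolUpper f ∧
    (⨆ y : ℝ, ⨆ _ : 0 < y, ∫⁻ x : ℝ,
      ENNReal.ofReal (((f (x + y * Complex.I))ᴴ * f (x + y * Complex.I)).trace.re)) < ⊤}

/-- The Carathéodory class. -/
def caratheodory (n : ℕ) : Set (ℂ → Matrix (Fin n) (Fin n) ℂ) :=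
  {f | HolUpper f ∧ ∀ z ∈ upperPlane, ((1 / 2 : ℂ) • (f z + (f z)ᴴ)).PosSemidef}

/-- The Schur class: holomorphic in `ℂ₊` with operator norm (with respect to the Euclidean norm)
at most one. -/
def schur (n : ℕ) : Set (ℂ → Matrix (Fin n) (Fin n) ℂ) :=
  {f | HolUpper f ∧ ∀ z ∈ upperPlane, ‖Matrix.toEuclideanCLM (n := Fin n) (𝕜 := ℂ) (f z)‖ ≤ 1}

/-- The inner functions: Schur functions with unitary boundary values almost everywhere. -/
def innerClass (n : ℕ) : Set (ℂ → Matrix (Fin n) (Fin n) ℂ) :=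
  {f | f ∈ schur n ∧ ∀ᵐ x : ℝ, ∃ L, HasBoundaryValue f x L ∧ L * Lᴴ = 1}

/-- The meromorphic function represented by `g` on `ℂ₊` belongs to the class `𝒞` of functions
holomorphic in `ℂ₊`: after removal of removable singularities, that is, off a set of isolated
points of `ℂ₊`, it coincides with a member of `𝒞`. -/
def BelongsTo {n : ℕ} (g : ℂ → Matrix (Fin n) (Fin n) ℂ)
    (𝒞 : Set (ℂ → Matrix (Fin n) (Fin n) ℂ)) : Prop :=
  ∃ f ∈ 𝒞, g =ᶠ[codiscreteWithin upperPlane] f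

/-- The class `P(J)`: meromorphic in `ℂ₊`, with `A(z)^* J A(z) ≤ J` wherever `A` is
holomorphic. -/
def classP {ι : Type*} [Fintype ι] (J : Matrix ι ι ℂ) : Set (ℂ → Matrix ι ι ℂ) :=
  {A | MeroUpper A ∧ ∀ z ∈ upperPlane, HolAt A z → (J - (A z)ᴴ * J * A z).PosSemidef}

/-- The class `U(J)` of `J`-inner functions. -/
def classU {ι : Type*} [Fintype ι] (J : Matrix ι ι ℂ) : Set (ℂ → Matrix ι ι ℂ) :=
  {A | A ∈ classP J ∧ ∀ᵐ x : ℝ, ∃ L, HasBoundaryValue A x L ∧ Lᴴ * J * L = J}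

/-- A `J`-inner function lives on `ℂ₊` and is continued to the lower half plane by the symmetry
principle `A(z) = J {A^#(z)}⁻¹ J`; this is its meromorphic pseudocontinuation
(`tendsto_continued` below: the boundary values from the two sides agree). -/
def continued {ι : Type*} [Fintype ι] [DecidableEq ι] (J : Matrix ι ι ℂ)
    (A : ℂ → Matrix ι ι ℂ) : ℂ → Matrix ι ι ℂ :=
  fun z => if z.im < 0 then J * (sharp A z)⁻¹ * J else A z

/-- If the boundary value `L` of `A` at `x` is `J`-unitary, then it is also the boundary value at
`x`, from the lower half plane, of the continuation of `A`. -/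
theorem tendsto_continued {ι : Type*} [Fintype ι] [DecidableEq ι] {J : Matrix ι ι ℂ}
    (hJ : J * J = 1) {A : ℂ → Matrix ι ι ℂ} {x : ℝ} {L : Matrix ι ι ℂ}
    (hA : HasBoundaryValue A x L) (hL : Lᴴ * J * L = J) (α : ℝ) (hα : 0 < α) :
    Tendsto (fun z => continued J A (starRingEnd ℂ z))
      (𝓝[angle x α ∩ {z | HolAt A z}] (x : ℂ)) (𝓝 L) := by
  have h1 : Lᴴ * (J * L * J) = 1 := by
    rw [← Matrix.mul_assoc, ← Matrix.mul_assoc, hL, hJ]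
  have hdet : (Lᴴ).det ≠ 0 := by
    intro h
    have h2 := congrArg Matrix.det h1
    rw [Matrix.det_mul, h, zero_mul, Matrix.det_one] at h2
    exact zero_ne_one h2
  have hinv : (Lᴴ)⁻¹ = J * L * J := Matrix.inv_eq_right_inv h1
  have hT : Tendsto (fun z => (A z)ᴴ) (𝓝[angle x α ∩ {z | HolAt A z}] (x : ℂ)) (𝓝 Lᴴ) :=
    (continuous_id.matrix_conjTranspose.tendsto L).comp (hA α hα)
  have hTi : Tendsto (fun z => ((A z)ᴴ)⁻¹) (𝓝[angle x α ∩ {z | HolAt A z}] (x : ℂ))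
      (𝓝 (Lᴴ)⁻¹) := by
    simp only [Matrix.inv_def, Ring.inverse_eq_inv']
    exact (((continuous_id.matrix_det.tendsto Lᴴ).comp hT).inv₀ hdet).smul
      ((continuous_id.matrix_adjugate.tendsto Lᴴ).comp hT)
  have hfin : Tendsto (fun z => J * ((A z)ᴴ)⁻¹ * J)
      (𝓝[angle x α ∩ {z | HolAt A z}] (x : ℂ)) (𝓝 (J * (Lᴴ)⁻¹ * J)) :=
    (tendsto_const_nhds.mul hTi).mul tendsto_const_nhds
  have hval : J * (Lᴴ)⁻¹ * J = L := by
    rw [hinv]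
    calc J * (J * L * J) * J = (J * J) * L * (J * J) := by simp only [Matrix.mul_assoc]
      _ = L := by rw [hJ, Matrix.one_mul, Matrix.mul_one]
  rw [hval] at hfin
  refine hfin.congr' ?_
  filter_upwards [self_mem_nhdsWithin] with z hz
  have hz' : (starRingEnd ℂ z).im < 0 := by
    simpa using hz.1.1
  simp only [continued, sharp, if_pos hz', starRingEnd_self_apply]

/-- `j_m = diag(I_n, -I_n)`, with `m = 2n`. -/
def smallJ (n : ℕ) : Matrix (Fin n ⊕ Fin n) (Fin n ⊕ Fin n) ℂ :=
  Matrix.fromBlocks 1 0 0 (-1)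

/-- `𝒥_m = [0, i I_n; -i I_n, 0]`. -/
def scriptJ (n : ℕ) : Matrix (Fin n ⊕ Fin n) (Fin n ⊕ Fin n) ℂ :=
  Matrix.fromBlocks 0 (Complex.I • 1) (-Complex.I • 1) 0

/-- `M = (1/√2) [i I_n, -i I_n; I_n, I_n]`. -/
def matM (n : ℕ) : Matrix (Fin n ⊕ Fin n) (Fin n ⊕ Fin n) ℂ :=
  ((1 / Real.sqrt 2 : ℝ) : ℂ) •
    Matrix.fromBlocks (Complex.I • 1) (-Complex.I • 1) 1 1

/-- `U(z) = A(z) M`. -/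
def matU {n : ℕ} (A : ℂ → Matrix (Fin n ⊕ Fin n) (Fin n ⊕ Fin n) ℂ) :
    ℂ → Matrix (Fin n ⊕ Fin n) (Fin n ⊕ Fin n) ℂ :=
  fun z => A z * matM n

/-- The block `u₁₁` of `U = A M`. -/
def u11 {n : ℕ} (A : ℂ → Matrix (Fin n ⊕ Fin n) (Fin n ⊕ Fin n) ℂ) :
    ℂ → Matrix (Fin n) (Fin n) ℂ :=
  fun z => (matU A z).toBlocks₁₁

/-- The block `u₁₂` of `U = A M`. -/
def u12 {n : ℕ} (A : ℂ → Matrix (Fin n ⊕ Fin n) (Fin n ⊕ Fin n) ℂ) :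
    ℂ → Matrix (Fin n) (Fin n) ℂ :=
  fun z => (matU A z).toBlocks₁₂

/-- The block `u₂₂` of `U = A M`. -/
def u22 {n : ℕ} (A : ℂ → Matrix (Fin n ⊕ Fin n) (Fin n ⊕ Fin n) ℂ) :
    ℂ → Matrix (Fin n) (Fin n) ℂ :=
  fun z => (matU A z).toBlocks₂₂

end DeBranges

end

/-! ### Positive harmonic functions on the half plane and a criterion for `H²` -/

namespace DeBranges

/-! Everything rests on the positivity of `j - U* 𝒥 U`, which follows from `A ∈ P(𝒥)` and `M* 𝒥 M =
j`. Testing it on block columns `(p, q)` (`posSemidef_block_column`) gives all pointwise facts at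
once. A column `(0, v)` with `u₁₂ v = 0` forces `v = 0`; `(0, u₁₂⁻¹)` gives `Φ + Φ* ⪰ u₁₂⁻* u₁₂⁻¹`;
`(1, -χ)` gives `χ* χ ⪯ 1`; and a column with first entry `X*`, where `X = i(u₂₁ - u₂₂ u₁₂⁻¹ u₁₁)`,
gives `Φ + Φ* ⪰ X X*`. A meromorphic function that is bounded or has nonnegative real part has only
removable singularities, so `Φ` and `χ` extend holomorphically and the closed inequalities persist.

For `H²`, the Hilbert-Schmidt norms squared of `u₁₂⁻¹` and `X` are thus at most `2 Re tr Φ`, where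
`Re tr Φ` is a nonnegative harmonic function. On the line of height `y`, `|ρ_i|⁻²` is a multiple of
a Poisson kernel, so the integral is controlled by `tr Φ` at `i(2y + 1)`. Harnack's linear bound
along the imaginary axis matches the decay of the multiple and makes the estimate uniform in `y`
(`smul_mem_hardyTwo`).

For `A ∈ U(𝒥)` the symmetry principle reads `U^# 𝒥 U = j`. Its blocks identify `{u₁₁^#}⁻¹` with `X`
and `χ` with `u₁₂^# {u₁₁^#}⁻¹`. The same algebra at a boundary point, with `U*` in place of `U^#`,
makes the boundary values of `χ` unitary. -/

lemma isOpen_upperPlane : IsOpen upperPlane :=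
  isOpen_lt continuous_const Complex.continuous_im

lemma isPreconnected_upperPlane : IsPreconnected upperPlane :=
  (convex_halfSpace_im_gt 0).isPreconnected

/-- The imaginary part of the Cayley map `w ↦ iy + is(1 + w)/(1 - w)`. -/
lemma im_cayley (y s : ℝ) (w : ℂ) :
    (y * Complex.I + s * Complex.I * ((1 + w) / (1 - w))).im =
      y + s * ((1 - ‖w‖ ^ 2) / ‖1 - w‖ ^ 2) := by
  have h : ((1 + w) / (1 - w)).re = (1 - ‖w‖ ^ 2) / ‖1 - w‖ ^ 2 := by
    rw [Complex.div_re, ← Complex.normSq_eq_norm_sq, ← Complex.normSq_eq_norm_sq, ← add_div]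
    congr 1
    simp [Complex.normSq_apply]
    ring
  have h2 : (s * Complex.I * ((1 + w) / (1 - w))).im = s * ((1 + w) / (1 - w)).re := by
    rw [mul_assoc, Complex.im_ofReal_mul, Complex.I_mul_im]
  rw [Complex.add_im, h2, h]
  simp

lemma cayley_mem_upperPlane {y s : ℝ} (hy : 0 ≤ y) (hs : 0 < s) {w : ℂ} (hw : ‖w‖ < 1) :
    y * Complex.I + s * Complex.I * ((1 + w) / (1 - w)) ∈ upperPlane := by
  have hw1 : w ≠ 1 := by rintro rfl; simp at hw
  have h0 : 0 < ‖1 - w‖ := norm_pos_iff.2 (sub_ne_zero.2 hw1.symm)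
  have h1 : 0 < 1 - ‖w‖ ^ 2 := by nlinarith [norm_nonneg w]
  show 0 < Complex.im _
  rw [im_cayley y s w]
  positivity

lemma differentiableAt_cayley (y s : ℝ) {w : ℂ} (hw : w ≠ 1) :
    DifferentiableAt ℂ (fun w : ℂ => y * Complex.I + s * Complex.I * ((1 + w) / (1 - w))) w := by
  have : 1 - w ≠ 0 := sub_ne_zero.2 hw.symm
  fun_prop (disch := assumption)

lemma differentiableOn_comp_cayley {φ : ℂ → ℂ} (hφ : DifferentiableOn ℂ φ upperPlane) {y s : ℝ}
    (hy : 0 ≤ y) (hs : 0 < s) :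
    DifferentiableOn ℂ (fun w : ℂ => φ (y * Complex.I + s * Complex.I * ((1 + w) / (1 - w))))
      (Metric.ball 0 1) := by
  intro w hw
  have hw' : ‖w‖ < 1 := by simpa using hw
  have hw1 : w ≠ 1 := by rintro rfl; simp at hw'
  refine DifferentiableAt.differentiableWithinAt ?_
  exact DifferentiableAt.comp w
    (hφ.differentiableAt (isOpen_upperPlane.mem_nhds (cayley_mem_upperPlane hy hs hw')))
    (differentiableAt_cayley y s hw1)

/-- **Harnack's inequality** along the imaginary axis for functions with nonnegative real part. -/
lemma norm_le_mul_norm_of_re_nonneg {φ : ℂ → ℂ} (hφ : DifferentiableOn ℂ φ upperPlane)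
    (hre : ∀ z ∈ upperPlane, 0 ≤ (φ z).re) {η : ℝ} (hη : 1 ≤ η) :
    ‖φ (η * Complex.I)‖ ≤ η * ‖φ Complex.I‖ := by
  set F : ℂ → ℂ := fun w => -φ ((0 : ℝ) * Complex.I + (1 : ℝ) * Complex.I * ((1 + w) / (1 - w)))
  have hF : DifferentiableOn ℂ F (Metric.ball 0 1) :=
    (differentiableOn_comp_cayley hφ le_rfl one_pos).neg
  -- Chosen so that `(1 + r)/(1 - r) = η`: the Cayley map with `y = 0`, `s = 1` takes `r` to `iη`
  -- and `0` to `i`.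
  set r : ℝ := (η - 1) / (η + 1)
  have hr0 : 0 ≤ r := by apply div_nonneg <;> linarith
  have hr1 : r < 1 := by rw [div_lt_one] <;> linarith
  have hnr : ‖(r : ℂ)‖ = r := by simp [abs_of_nonneg hr0]
  have hz : (r : ℂ) ∈ Metric.ball (0 : ℂ) 1 := by simpa [hnr, abs_of_nonneg hr0] using hr1
  have hη1 : (η + 1 : ℂ) ≠ 0 := by
    norm_cast
    linarith
  have hFr : F r = -φ (η * Complex.I) := by
    have h : (1 + (r : ℂ)) / (1 - r) = η := by
      have h1 : (1 : ℂ) - r = 2 / (η + 1) := by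
        simp only [r]; push_cast; field_simp; ring
      have h2 : (1 : ℂ) + r = 2 * η / (η + 1) := by
        simp only [r]; push_cast; field_simp; ring
      rw [h1, h2]; field_simp
    simp only [F]
    rw [h]; congr 2; push_cast; ring
  have hF0 : F 0 = -φ Complex.I := by simp [F]
  have hq : (1 + r) / (1 - r) = η := by
    have : η + 1 ≠ 0 := by linarith
    have h1 : 1 - r = 2 / (η + 1) := by simp only [r]; field_simp; ring
    have h2 : 1 + r = 2 * η / (η + 1) := by simp only [r]; field_simp; ring
    rw [h1, h2]; field_simp
  -- Since `Re F ≤ 0`, Borel–Carathéodory applies with every `M > 0`; letting `M → 0` leaves exactly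
  -- the factor `η`.
  have key : ∀ M : ℝ, 0 < M → ‖φ (η * Complex.I)‖ ≤ M * (2 * r / (1 - r)) + η * ‖φ Complex.I‖ := by
    intro M hM
    have := Complex.borelCaratheodory hM hF (fun w hw => ?_) one_pos hz
    · rw [hFr, hF0, norm_neg, norm_neg, hnr, mul_div_assoc ‖_‖, hq] at this
      calc _ ≤ _ := this
        _ = _ := by ring
    · have := hre _ (cayley_mem_upperPlane le_rfl one_pos (by simpa using hw : ‖w‖ < 1))
      show (F w).re ≤ M
      simp only [F, Complex.neg_re]
      linarith
  have hlim : Tendsto (fun M : ℝ => M * (2 * r / (1 - r)) + η * ‖φ Complex.I‖) (𝓝[>] 0)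
      (𝓝 (0 * (2 * r / (1 - r)) + η * ‖φ Complex.I‖)) := by
    refine Tendsto.mono_left (Continuous.tendsto (by fun_prop) 0) nhdsWithin_le_nhds
  rw [zero_mul, zero_add] at hlim
  exact ge_of_tendsto hlim (by filter_upwards [self_mem_nhdsWithin] with M hM using key M hM)

/-- The mean value over a circle of radius less than one, as a Lebesgue integral. -/
lemma lintegral_circle_re_eq {F : ℂ → ℂ} (hF : DifferentiableOn ℂ F (Metric.ball 0 1))
    (hre : ∀ w ∈ Metric.ball (0 : ℂ) 1, 0 ≤ (F w).re) {r : ℝ} (hr0 : 0 < r) (hr : r < 1) :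
    ∫⁻ θ in Set.Ioc 0 (2 * Real.pi), ENNReal.ofReal (F (circleMap 0 r θ)).re =
      ENNReal.ofReal (2 * Real.pi * (F 0).re) := by
  have hmem : ∀ θ, circleMap 0 r θ ∈ Metric.ball (0 : ℂ) 1 := fun θ => by
    simpa [abs_of_pos hr0] using hr
  have hd : DiffContOnCl ℂ F (Metric.ball 0 |r|) := by
    apply DifferentiableOn.diffContOnCl
    refine hF.mono ?_
    rw [abs_of_pos hr0]
    exact (Metric.closure_ball_subset_closedBall).trans (Metric.closedBall_subset_ball hr)
  have hcont : Continuous fun θ => F (circleMap 0 r θ) :=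
    hF.continuousOn.comp_continuous (continuous_circleMap 0 r) hmem
  have hav := hd.circleAverage
  rw [Real.circleAverage_def] at hav
  have hpi : (0 : ℝ) < 2 * Real.pi := by positivity
  have hint : ∫ θ in (0 : ℝ)..2 * Real.pi, (F (circleMap 0 r θ)).re = 2 * Real.pi * (F 0).re := by
    have h1 : ∫ θ in (0 : ℝ)..2 * Real.pi, (F (circleMap 0 r θ)).re =
        (∫ θ in (0 : ℝ)..2 * Real.pi, F (circleMap 0 r θ)).re := by
      have := Complex.reCLM.intervalIntegral_comp_comm
        (hcont.intervalIntegrable (μ := volume) 0 (2 * Real.pi))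
      simpa using this
    rw [h1, ← hav, Complex.real_smul, Complex.re_ofReal_mul]
    field_simp
  rw [← hint, intervalIntegral.integral_of_le hpi.le, ofReal_integral_eq_lintegral_ofReal]
  · exact (Complex.continuous_re.comp hcont).integrableOn_Ioc
  · exact ae_of_all _ fun θ => hre _ (hmem θ)

lemma exp_two_arctan_mul_I (t : ℝ) :
    Complex.exp (((2 * Real.arctan t : ℝ) : ℂ) * Complex.I) =
      (1 + t * Complex.I) / (1 - t * Complex.I) := by
  have hpos : 0 < 1 + t ^ 2 := by positivity
  have hne : (1 : ℂ) - t * Complex.I ≠ 0 := by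
    intro h
    have := congrArg Complex.re h
    simp at this
  rw [Complex.exp_mul_I, ← Complex.ofReal_cos, ← Complex.ofReal_sin, Real.cos_two_mul,
    Real.sin_two_mul, Real.cos_sq_arctan]
  have hs : 2 * Real.sin (Real.arctan t) * Real.cos (Real.arctan t) = 2 * t * (1 / (1 + t ^ 2)) := by
    rw [← Real.cos_sq_arctan]
    have : Real.sin (Real.arctan t) = t * Real.cos (Real.arctan t) := by
      rw [Real.sin_arctan, Real.cos_arctan]; ring
    rw [this]; ring
  rw [hs, eq_div_iff hne]
  have hc : (1 + (t : ℂ) ^ 2) ≠ 0 := by exact_mod_cast hpos.ne'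
  push_cast
  field_simp
  linear_combination (-(2 : ℂ) * t ^ 2) * Complex.I_sq

/-- The substitution turning the mean over the unit circle into a Poisson integral over the line of
height `y`. The shift by `π` puts `w = 1`, the preimage of infinity, at the ends of the angular
interval. -/
lemma cayley_circleMap_arctan (y : ℝ) {s : ℝ} (hs : 0 < s) (x : ℝ) :
    (y * Complex.I + s * Complex.I * ((1 + circleMap 0 1 (Real.pi + 2 * Real.arctan (x / s))) /
      (1 - circleMap 0 1 (Real.pi + 2 * Real.arctan (x / s)))) : ℂ) = x + y * Complex.I := by
  have hs' : (s : ℂ) ≠ 0 := by exact_mod_cast hs.ne'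
  have h : circleMap 0 1 (Real.pi + 2 * Real.arctan (x / s)) =
      -((1 + (x / s : ℝ) * Complex.I) / (1 - (x / s : ℝ) * Complex.I)) := by
    rw [← exp_two_arctan_mul_I, circleMap]
    push_cast
    rw [add_mul, Complex.exp_add, Complex.exp_pi_mul_I]
    ring
  set t : ℝ := x / s
  have hx : (x : ℂ) = s * t := by simp only [t]; push_cast; field_simp
  have hne : (1 : ℂ) - t * Complex.I ≠ 0 := by
    intro h
    have := congrArg Complex.re h
    simp at this
  have h1 : (1 : ℂ) + -((1 + t * Complex.I) / (1 - t * Complex.I)) =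
      -2 * t * Complex.I / (1 - t * Complex.I) := by field_simp; ring
  have h2 : (1 : ℂ) - -((1 + t * Complex.I) / (1 - t * Complex.I)) =
      2 / (1 - t * Complex.I) := by field_simp; ring
  have h3 : -2 * t * Complex.I / (1 - t * Complex.I) / (2 / (1 - t * Complex.I)) =
      -(t * Complex.I) := by field_simp
  rw [h, h1, h2, h3, hx]
  linear_combination (-(s : ℂ) * t) * Complex.I_sq

lemma image_pi_add_two_arctan {s : ℝ} (hs : 0 < s) :
    (fun x : ℝ => Real.pi + 2 * Real.arctan (x / s)) '' Set.univ = Set.Ioo 0 (2 * Real.pi) := by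
  ext θ
  simp only [Set.image_univ, Set.mem_range, Set.mem_Ioo]
  constructor
  · rintro ⟨x, rfl⟩
    have h1 := Real.neg_pi_div_two_lt_arctan (x / s)
    have h2 := Real.arctan_lt_pi_div_two (x / s)
    constructor <;> linarith
  · rintro ⟨h1, h2⟩
    refine ⟨s * Real.tan ((θ - Real.pi) / 2), ?_⟩
    rw [mul_div_cancel_left₀ _ hs.ne', Real.arctan_tan] <;> linarith

/-- A Poisson integral over a horizontal line does not exceed the value of the harmonic function. -/
lemma lintegral_poisson_le {φ : ℂ → ℂ} (hφ : DifferentiableOn ℂ φ upperPlane)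
    (hre : ∀ z ∈ upperPlane, 0 ≤ (φ z).re) {y s : ℝ} (hy : 0 < y) (hs : 0 < s) :
    ∫⁻ x : ℝ, ENNReal.ofReal (2 * s / (x ^ 2 + s ^ 2)) *
        ENNReal.ofReal (φ (x + y * Complex.I)).re ≤
      ENNReal.ofReal (2 * Real.pi * (φ ((y + s : ℝ) * Complex.I)).re) := by
  set F : ℂ → ℂ := fun w => φ (y * Complex.I + s * Complex.I * ((1 + w) / (1 - w)))
  have hF : DifferentiableOn ℂ F (Metric.ball 0 1) := differentiableOn_comp_cayley hφ hy.le hs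
  have hFre : ∀ w ∈ Metric.ball (0 : ℂ) 1, 0 ≤ (F w).re := fun w hw =>
    hre _ (cayley_mem_upperPlane hy.le hs (by simpa using hw))
  set θ : ℝ → ℝ := fun x => Real.pi + 2 * Real.arctan (x / s)
  have hder : ∀ x ∈ Set.univ, HasDerivWithinAt θ (2 * s / (x ^ 2 + s ^ 2)) Set.univ x := by
    intro x _
    have h := (((Real.hasDerivAt_arctan (x / s)).comp x
      ((hasDerivAt_id x).div_const s)).const_mul 2).const_add Real.pi
    refine HasDerivAt.hasDerivWithinAt ?_
    have h1 : 1 + (x / s) ^ 2 = (x ^ 2 + s ^ 2) / s ^ 2 := by field_simp; ring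
    have heq : 2 * s / (x ^ 2 + s ^ 2) = 2 * (1 / (1 + (x / s) ^ 2) * (1 / s)) := by
      rw [h1]; field_simp
    rw [heq]
    exact h
  have hinj : Set.InjOn θ Set.univ := by
    intro a _ b _ hab
    have : Real.arctan (a / s) = Real.arctan (b / s) := by
      simp only [θ] at hab; linarith
    have := Real.arctan_injective this
    field_simp at this
    exact this
  have hcv := lintegral_image_eq_lintegral_abs_deriv_mul MeasurableSet.univ hder hinj
    (fun t => ENNReal.ofReal (F (circleMap 0 1 t)).re)
  rw [image_pi_add_two_arctan hs] at hcv
  have hlhs : ∫⁻ x : ℝ, ENNReal.ofReal (2 * s / (x ^ 2 + s ^ 2)) *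
      ENNReal.ofReal (φ (x + y * Complex.I)).re =
      ∫⁻ t in Set.Ioo 0 (2 * Real.pi), ENNReal.ofReal (F (circleMap 0 1 t)).re := by
    rw [hcv, Measure.restrict_univ]
    refine lintegral_congr fun x => ?_
    have h0 : 0 ≤ 2 * s / (x ^ 2 + s ^ 2) := by positivity
    simp only [F, θ]
    rw [abs_of_nonneg h0, cayley_circleMap_arctan y hs x]
  rw [hlhs]
  -- `F` need not extend continuously to `w = 1`, so the mean value property is used on radii
  -- increasing to `1` and passed to the limit by Fatou. This is why only an inequality results. The
  -- `+ 2` keeps every radius positive.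
  set r : ℕ → ℝ := fun k => 1 - 1 / ((k : ℝ) + 2)
  have hr0 : ∀ k, 0 < r k := fun k => by
    have : 1 / ((k : ℝ) + 2) < 1 := by
      rw [div_lt_one (by positivity)]; have : (0 : ℝ) ≤ k := by positivity
      linarith
    simp only [r]; linarith
  have hr1 : ∀ k, r k < 1 := fun k => by
    have : 0 < 1 / ((k : ℝ) + 2) := by positivity
    simp only [r]; linarith
  have hrlim : Tendsto r atTop (𝓝 1) := by
    have h : Tendsto (fun k : ℕ => 1 / ((k : ℝ) + 2)) atTop (𝓝 0) := by
      simp only [one_div]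
      exact tendsto_inv_atTop_zero.comp
        (tendsto_atTop_add_const_right _ _ tendsto_natCast_atTop_atTop)
    simpa [r] using h.const_sub 1
  have hmeas : ∀ k, AEMeasurable (fun t => ENNReal.ofReal (F (circleMap 0 (r k) t)).re)
      (volume.restrict (Set.Ioo 0 (2 * Real.pi))) := fun k => by
    have hcont : Continuous fun t => F (circleMap 0 (r k) t) :=
      hF.continuousOn.comp_continuous (continuous_circleMap 0 (r k)) fun t => by
        simpa [abs_of_pos (hr0 k)] using hr1 k
    exact (ENNReal.measurable_ofReal.comp
      (Complex.continuous_re.comp hcont).measurable).aemeasurable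
  calc ∫⁻ t in Set.Ioo 0 (2 * Real.pi), ENNReal.ofReal (F (circleMap 0 1 t)).re
      = ∫⁻ t in Set.Ioo 0 (2 * Real.pi),
          liminf (fun k => ENNReal.ofReal (F (circleMap 0 (r k) t)).re) atTop := by
        refine setLIntegral_congr_fun measurableSet_Ioo fun t ht => ?_
        have hne : circleMap 0 1 t ≠ 1 := by
          intro h
          have h1 : circleMap 0 1 t = circleMap 0 1 0 := by rw [h]; simp [circleMap]
          exact ht.1.ne' (injOn_circleMap_of_abs_sub_le' one_ne_zero (by simp)
            (⟨ht.1.le, ht.2⟩ : t ∈ Set.Ico 0 (2 * Real.pi)) ⟨le_rfl, by positivity⟩ h1)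
        have hFc : ContinuousAt F (circleMap 0 1 t) := by
          have hm : y * Complex.I + s * Complex.I * ((1 + circleMap 0 1 t) / (1 - circleMap 0 1 t))
              ∈ upperPlane := by
            show 0 < Complex.im _
            rw [im_cayley]
            simpa using hy
          exact ContinuousAt.comp (f := fun w : ℂ =>
              y * Complex.I + s * Complex.I * ((1 + w) / (1 - w)))
            (hφ.differentiableAt (isOpen_upperPlane.mem_nhds hm)).continuousAt
            (differentiableAt_cayley y s hne).continuousAt
        have hc : Tendsto (fun k => circleMap 0 (r k) t) atTop (𝓝 (circleMap 0 1 t)) := by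
          have : Continuous fun ρ : ℝ => circleMap 0 ρ t := by unfold circleMap; fun_prop
          exact (this.tendsto 1).comp hrlim
        exact ((ENNReal.continuous_ofReal.tendsto _).comp
          ((Complex.continuous_re.tendsto _).comp (hFc.tendsto.comp hc))).liminf_eq.symm
    _ ≤ liminf (fun k => ∫⁻ t in Set.Ioo 0 (2 * Real.pi),
          ENNReal.ofReal (F (circleMap 0 (r k) t)).re) atTop := lintegral_liminf_le' hmeas
    _ = ENNReal.ofReal (2 * Real.pi * (φ ((y + s : ℝ) * Complex.I)).re) := by
        have : ∀ k, ∫⁻ t in Set.Ioo 0 (2 * Real.pi), ENNReal.ofReal (F (circleMap 0 (r k) t)).re =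
            ENNReal.ofReal (2 * Real.pi * (φ ((y + s : ℝ) * Complex.I)).re) := fun k => by
          rw [setLIntegral_congr Ioo_ae_eq_Ioc, lintegral_circle_re_eq hF hFre (hr0 k) (hr1 k)]
          simp only [F]
          congr 4
          push_cast
          ring
        simp only [this, liminf_const]

lemma norm_rho_I_inv_sq (x y : ℝ) :
    ‖(rho Complex.I (x + y * Complex.I))⁻¹‖ ^ 2 =
      1 / (4 * Real.pi ^ 2 * (x ^ 2 + (y + 1) ^ 2)) := by
  have h1 : rho Complex.I (x + y * Complex.I) =
      (-2 * Real.pi : ℝ) * Complex.I * (x + (y + 1 : ℝ) * Complex.I) := by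
    simp only [rho, Complex.conj_I]
    push_cast
    ring
  rw [h1, norm_inv, norm_mul, norm_mul, Complex.norm_I, Complex.norm_real, inv_pow, mul_pow,
    mul_pow, ← Complex.normSq_eq_norm_sq, Complex.normSq_add_mul_I, Real.norm_eq_abs, sq_abs,
    one_div]
  ring

lemma re_trace_conjTranspose_smul {n : ℕ} (c : ℂ) (G : Matrix (Fin n) (Fin n) ℂ) :
    (((c • G)ᴴ * (c • G)).trace).re = ‖c‖ ^ 2 * ((Gᴴ * G).trace).re := by
  rw [Matrix.conjTranspose_smul, Matrix.smul_mul, Matrix.mul_smul, smul_smul, Matrix.trace_smul,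
    smul_eq_mul, ← Complex.normSq_eq_norm_sq, ← Complex.re_ofReal_mul, Complex.normSq_eq_conj_mul_self]
  rfl

lemma differentiableAt_rho_inv {z : ℂ} (hz : z ∈ upperPlane) :
    DifferentiableAt ℂ (fun w => (rho Complex.I w)⁻¹) z := by
  have hz' : 0 < z.im := hz
  have h : rho Complex.I z ≠ 0 := by
    have hI : z + Complex.I ≠ 0 := by
      intro h
      have := congrArg Complex.im h
      simp at this
      linarith
    simp [rho, Complex.I_ne_zero, Real.pi_ne_zero, hI]
  have hd : DifferentiableAt ℂ (rho Complex.I) z := by unfold rho; fun_prop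
  exact hd.inv h

/-- A holomorphic function whose Hilbert-Schmidt norm is dominated by a positive harmonic function
is in `H²` after division by `ρ_i`. -/
lemma smul_mem_hardyTwo {n : ℕ} {G : ℂ → Matrix (Fin n) (Fin n) ℂ} (hG : HolUpper G) {φ : ℂ → ℂ}
    (hφ : DifferentiableOn ℂ φ upperPlane) (hre : ∀ z ∈ upperPlane, 0 ≤ (φ z).re)
    (h : ∀ z ∈ upperPlane, ((G z)ᴴ * G z).trace.re ≤ 2 * (φ z).re) :
    (fun z => (rho Complex.I z)⁻¹ • G z) ∈ hardyTwo n := by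
  refine ⟨fun i j z hz => ?_, ?_⟩
  · have := (differentiableAt_rho_inv hz).differentiableWithinAt.mul (hG i j z hz)
    exact this
  refine lt_of_le_of_lt (b := ENNReal.ofReal ‖φ Complex.I‖) (iSup₂_le fun y hy => ?_)
    ENNReal.ofReal_lt_top
  have hs : 0 < y + 1 := by linarith
  have hpi := Real.pi_gt_three
  -- With `s = y + 1`, `2 |ρ_i|⁻² = c · 2s/(x² + s²)`, the weight in `lintegral_poisson_le`.
  set c : ℝ := 1 / (4 * Real.pi ^ 2 * (y + 1))
  have hc : 0 ≤ c := by positivity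
  calc _ ≤ ∫⁻ x : ℝ, ENNReal.ofReal c * (ENNReal.ofReal (2 * (y + 1) / (x ^ 2 + (y + 1) ^ 2)) *
        ENNReal.ofReal (φ (x + y * Complex.I)).re) := by
        refine lintegral_mono fun x => ?_
        have hz : (x + y * Complex.I : ℂ) ∈ upperPlane := by
          show 0 < Complex.im _
          simpa using hy
        rw [re_trace_conjTranspose_smul, norm_rho_I_inv_sq, ← ENNReal.ofReal_mul (by positivity),
          ← ENNReal.ofReal_mul hc]
        refine ENNReal.ofReal_le_ofReal ?_
        calc _ ≤ 1 / (4 * Real.pi ^ 2 * (x ^ 2 + (y + 1) ^ 2)) * (2 * (φ (x + y * Complex.I)).re) :=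
              mul_le_mul_of_nonneg_left (h _ hz) (by positivity)
          _ = _ := by simp only [c]; field_simp
    _ = ENNReal.ofReal c * ∫⁻ x : ℝ, (ENNReal.ofReal (2 * (y + 1) / (x ^ 2 + (y + 1) ^ 2)) *
        ENNReal.ofReal (φ (x + y * Complex.I)).re) :=
        lintegral_const_mul' _ _ ENNReal.ofReal_ne_top
    _ ≤ ENNReal.ofReal c *
        ENNReal.ofReal (2 * Real.pi * (φ ((y + (y + 1) : ℝ) * Complex.I)).re) :=
        mul_le_mul_right (lintegral_poisson_le hφ hre hy hs) _
    _ ≤ ENNReal.ofReal ‖φ Complex.I‖ := by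
        rw [← ENNReal.ofReal_mul hc]
        refine ENNReal.ofReal_le_ofReal ?_
        -- Growth of order `2y + 1` against `c` of order `1/(y + 1)`: the product stays below a
        -- bound free of `y`.
        have h1 : (φ ((y + (y + 1) : ℝ) * Complex.I)).re ≤ (y + (y + 1)) * ‖φ Complex.I‖ :=
          (Complex.re_le_norm _).trans (norm_le_mul_norm_of_re_nonneg hφ hre (by linarith))
        calc c * (2 * Real.pi * (φ ((y + (y + 1) : ℝ) * Complex.I)).re)
            ≤ c * (2 * Real.pi * ((y + (y + 1)) * ‖φ Complex.I‖)) := by gcongr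
          _ = (2 * y + 1) / (2 * Real.pi * (y + 1)) * ‖φ Complex.I‖ := by
              simp only [c]; field_simp; ring
          _ ≤ 1 * ‖φ Complex.I‖ := by
              gcongr
              rw [div_le_one (by positivity)]
              nlinarith
          _ = _ := one_mul _

end DeBranges

/-! ### Codiscrete sets and meromorphic matrix functions -/

namespace DeBranges

lemma eventually_nhdsNE_of_codiscreteWithin {p : ℂ → Prop}
    (h : ∀ᶠ z in codiscreteWithin upperPlane, p z) {z : ℂ} (hz : z ∈ upperPlane) :
    ∀ᶠ w in 𝓝[≠] z, p w ∧ w ∈ upperPlane := by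
  have h1 : ∀ᶠ w in 𝓝[≠] z, w ∈ upperPlane :=
    nhdsWithin_le_nhds (isOpen_upperPlane.mem_nhds hz)
  have h2 := mem_codiscreteWithin_iff_forall_mem_nhdsNE.1 h z hz
  filter_upwards [h1, h2] with w hw hw'
  exact ⟨hw'.resolve_right fun hn => hn hw, hw⟩

/-- Closed conditions on a continuous function extend from a codiscrete set to the half plane. -/
lemma forall_mem_of_codiscreteWithin {X : Type*} [TopologicalSpace X] {F : ℂ → X}
    (hF : ContinuousOn F upperPlane) {S : Set X} (hS : IsClosed S)
    (h : ∀ᶠ z in codiscreteWithin upperPlane, F z ∈ S) : ∀ z ∈ upperPlane, F z ∈ S := by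
  intro z hz
  have hc : Tendsto F (𝓝[≠] z) (𝓝 (F z)) :=
    (hF.continuousAt (isOpen_upperPlane.mem_nhds hz)).tendsto.mono_left nhdsWithin_le_nhds
  exact hS.mem_of_tendsto hc
    ((eventually_nhdsNE_of_codiscreteWithin h hz).mono fun _ hw => hw.1)

section

variable {ι κ l : Type*}

lemma HolUpper.continuousOn {A : ℂ → Matrix ι κ ℂ} (hA : HolUpper A) :
    ContinuousOn A upperPlane :=
  continuousOn_pi.2 fun i => continuousOn_pi.2 fun j => (hA i j).continuousOn

lemma HolAt.continuousAt {A : ℂ → Matrix ι κ ℂ} {z : ℂ} (hA : HolAt A z) : ContinuousAt A z :=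
  continuousAt_pi.2 fun i => continuousAt_pi.2 fun j => (hA i j).continuousAt

lemma MeroUpper.eventually_holAt [Finite ι] [Finite κ] {A : ℂ → Matrix ι κ ℂ} (hA : MeroUpper A) :
    ∀ᶠ z in codiscreteWithin upperPlane, z ∈ upperPlane ∧ HolAt A z := by
  have h1 : ∀ᶠ z in codiscreteWithin upperPlane, z ∈ upperPlane :=
    self_mem_codiscreteWithin upperPlane
  refine h1.and (eventually_all.2 fun i => eventually_all.2 fun j => ?_)
  exact (hA i j).analyticAt_mem_codiscreteWithin

lemma MeroUpper.const (C : Matrix ι κ ℂ) : MeroUpper fun _ => C :=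
  fun _ _ => MeromorphicOn.const _

lemma MeroUpper.mul [Fintype κ] {A : ℂ → Matrix ι κ ℂ} {B : ℂ → Matrix κ l ℂ} (hA : MeroUpper A)
    (hB : MeroUpper B) : MeroUpper fun z => A z * B z := by
  intro i j
  simp only [Matrix.mul_apply]
  exact MeromorphicOn.fun_sum fun k => (hA i k).fun_mul (hB k j)

lemma MeroUpper.sub {A B : ℂ → Matrix ι κ ℂ} (hA : MeroUpper A) (hB : MeroUpper B) :
    MeroUpper fun z => A z - B z := fun i j => (hA i j).fun_sub (hB i j)

lemma MeroUpper.const_smul {A : ℂ → Matrix ι κ ℂ} (hA : MeroUpper A) (c : ℂ) :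
    MeroUpper fun z => c • A z := fun i j => (hA i j).fun_const_smul c

lemma MeroUpper.det [Fintype ι] [DecidableEq ι] {A : ℂ → Matrix ι ι ℂ} (hA : MeroUpper A) :
    MeromorphicOn (fun z => (A z).det) upperPlane := by
  simp only [Matrix.det_apply']
  exact MeromorphicOn.fun_sum fun σ =>
    (MeromorphicOn.const _).fun_mul (MeromorphicOn.fun_prod fun i _ => hA _ _)

lemma MeroUpper.inv [Fintype ι] [DecidableEq ι] {A : ℂ → Matrix ι ι ℂ} (hA : MeroUpper A) :
    MeroUpper fun z => (A z)⁻¹ := by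
  intro i j
  simp only [Matrix.inv_def, Ring.inverse_eq_inv', Matrix.smul_apply, smul_eq_mul,
    Matrix.adjugate_apply]
  refine hA.det.fun_inv.fun_mul (MeroUpper.det fun k m => ?_)
  by_cases hk : k = j
  · subst hk
    simpa using MeromorphicOn.const _
  · simpa [Matrix.updateRow_ne hk] using hA k m

end

/-! ### Removable singularities -/

section Removable

lemma exists_tendsto_of_bounded {f : ℂ → ℂ} {z : ℂ} (hf : MeromorphicAt f z) {C : ℝ}
    (h : ∀ᶠ w in 𝓝[≠] z, ‖f w‖ ≤ C) : ∃ c, Tendsto f (𝓝[≠] z) (𝓝 c) := by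
  rw [tendsto_nhds_iff_meromorphicOrderAt_nonneg hf]
  by_contra hneg
  have := tendsto_norm_atTop_iff_cobounded.2
    (tendsto_cobounded_of_meromorphicOrderAt_neg (not_le.1 hneg))
  obtain ⟨w, hw1, hw2⟩ := (h.and (this.eventually_gt_atTop C)).exists
  linarith

/-- A meromorphic function with nonnegative real part has no poles. -/
lemma exists_tendsto_of_re_nonneg {f : ℂ → ℂ} {z : ℂ} (hf : MeromorphicAt f z)
    (h : ∀ᶠ w in 𝓝[≠] z, 0 ≤ (f w).re) : ∃ c, Tendsto f (𝓝[≠] z) (𝓝 c) := by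
  rw [tendsto_nhds_iff_meromorphicOrderAt_nonneg hf]
  by_contra hneg
  have hcb := tendsto_cobounded_of_meromorphicOrderAt_neg (not_le.1 hneg)
  -- At a pole of `f`, `q` extends analytically by `0`, while `Re q > 0` nearby. Then `|exp(-q)|`
  -- has a local maximum at the pole, so `exp(-q)` is locally constant, which is impossible.
  set q : ℂ → ℂ := fun w => (1 + f w)⁻¹
  have hq : MeromorphicAt q z := ((MeromorphicAt.const 1 z).add hf).inv
  have hcb1 : Tendsto (fun w => 1 + f w) (𝓝[≠] z) (Bornology.cobounded ℂ) :=
    (tendsto_const_add_cobounded 1).comp hcb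
  have hq0 : Tendsto q (𝓝[≠] z) (𝓝 0) := tendsto_inv₀_cobounded.comp hcb1
  set p : ℂ → ℂ := Function.update q z 0
  have hpq : p =ᶠ[𝓝[≠] z] q := by
    filter_upwards [self_mem_nhdsWithin] with w hw
    exact Function.update_of_ne hw _ _
  have hp : AnalyticAt ℂ p z := by
    refine AnalyticAt.of_meromorphicOrderAt_pos ?_ (Function.update_self _ _ _)
    rw [meromorphicOrderAt_congr hpq]
    exact (tendsto_zero_iff_meromorphicOrderAt_pos hq).1 hq0
  have hre : ∀ᶠ w in 𝓝[≠] z, 0 < (p w).re := by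
    filter_upwards [hpq, h] with w hw hw'
    have h1 : 0 < (1 + f w).re := by simp; linarith
    have h2 : 0 < Complex.normSq (1 + f w) := by
      rw [Complex.normSq_pos]; intro h0; rw [h0] at h1; simp at h1
    rw [hw, Complex.inv_re]
    positivity
  have hp0 : p z = 0 := Function.update_self _ _ _
  have hmax : IsLocalMax (norm ∘ fun w => Complex.exp (-p w)) z := by
    have : ∀ᶠ w in 𝓝 z, w ≠ z → 0 < (p w).re := eventually_nhdsWithin_iff.1 hre
    filter_upwards [this] with w hw
    simp only [Function.comp, Complex.norm_exp, hp0]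
    rcases eq_or_ne w z with rfl | hne
    · simp [hp0]
    · simpa using (hw hne).le
  have hd : ∀ᶠ w in 𝓝 z, DifferentiableAt ℂ (fun w => Complex.exp (-p w)) w := by
    filter_upwards [hp.eventually_analyticAt] with w hw
    exact hw.differentiableAt.neg.cexp
  have hconst := Complex.eventually_eq_of_isLocalMax_norm hd hmax
  obtain ⟨w, hw1, hw2⟩ := (hre.and (hconst.filter_mono nhdsWithin_le_nhds)).exists
  have h3 := congrArg norm hw2
  simp only [Complex.norm_exp, hp0] at h3
  have h4 := Real.exp_injective h3
  simp at h4
  linarith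

variable {ι κ : Type*}

/-- A finite limit at each point means that the entries have nonnegative order, so their meromorphic
normal forms are analytic. -/
lemma MeroUpper.exists_holUpper [Finite ι] [Finite κ] {A : ℂ → Matrix ι κ ℂ} (hA : MeroUpper A)
    (h : ∀ z ∈ upperPlane, ∀ i j, ∃ c, Tendsto (fun w => A w i j) (𝓝[≠] z) (𝓝 c)) :
    ∃ f, HolUpper f ∧ A =ᶠ[codiscreteWithin upperPlane] f := by
  refine ⟨fun z => Matrix.of fun i j => toMeromorphicNFOn (fun w => A w i j) upperPlane z,
    fun i j z hz => ?_, ?_⟩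
  · have h1 : 0 ≤ meromorphicOrderAt (toMeromorphicNFOn (fun w => A w i j) upperPlane) z := by
      rw [meromorphicOrderAt_toMeromorphicNFOn (hA i j) hz,
        ← tendsto_nhds_iff_meromorphicOrderAt_nonneg (hA i j z hz)]
      exact h z hz i j
    exact ((meromorphicNFOn_toMeromorphicNFOn _ _ hz).meromorphicOrderAt_nonneg_iff_analyticAt.1
      h1).differentiableAt.differentiableWithinAt
  · have : ∀ᶠ z in codiscreteWithin upperPlane, ∀ i j,
        A z i j = toMeromorphicNFOn (fun w => A w i j) upperPlane z :=
      eventually_all.2 fun i => eventually_all.2 fun j => toMeromorphicNFOn_eqOn_codiscrete (hA i j)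
    filter_upwards [this] with z hz
    ext i j
    exact hz i j

lemma re_trace_conjTranspose_mul_self [Fintype ι] [Fintype κ] (M : Matrix ι κ ℂ) :
    (Mᴴ * M).trace.re = ∑ j, ∑ i, ‖M i j‖ ^ 2 := by
  simp only [Matrix.trace, Matrix.diag, Matrix.mul_apply, Matrix.conjTranspose_apply, Complex.re_sum]
  refine Finset.sum_congr rfl fun j _ => Finset.sum_congr rfl fun i _ => ?_
  rw [Complex.star_def, ← Complex.normSq_eq_conj_mul_self, Complex.ofReal_re,
    Complex.normSq_eq_norm_sq]

lemma norm_sq_le_re_trace [Fintype ι] [Fintype κ] (M : Matrix ι κ ℂ) (i : ι) (j : κ) :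
    ‖M i j‖ ^ 2 ≤ (Mᴴ * M).trace.re := by
  rw [re_trace_conjTranspose_mul_self]
  calc ‖M i j‖ ^ 2 ≤ ∑ i, ‖M i j‖ ^ 2 :=
        Finset.single_le_sum (f := fun i => ‖M i j‖ ^ 2) (fun _ _ => by positivity)
          (Finset.mem_univ i)
    _ ≤ _ := Finset.single_le_sum (f := fun j => ∑ i, ‖M i j‖ ^ 2) (fun _ _ => by positivity)
          (Finset.mem_univ j)

/-- A meromorphic matrix function that is dominated by a continuous function has only removable
singularities. -/
lemma MeroUpper.exists_holUpper_of_trace_le [Fintype ι] [Fintype κ] {A : ℂ → Matrix ι κ ℂ}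
    (hA : MeroUpper A) {b : ℂ → ℝ} (hb : ContinuousOn b upperPlane)
    (h : ∀ᶠ z in codiscreteWithin upperPlane, ((A z)ᴴ * A z).trace.re ≤ b z) :
    ∃ f, HolUpper f ∧ A =ᶠ[codiscreteWithin upperPlane] f := by
  refine hA.exists_holUpper fun z hz i j => ?_
  have hbz := (hb.continuousAt (isOpen_upperPlane.mem_nhds hz)).tendsto.mono_left
    (nhdsWithin_le_nhds (s := {z}ᶜ))
  -- Near `z` the squared entry is below `|b z| + 1`, so the entry itself is below `|b z| + 2`.
  refine exists_tendsto_of_bounded (hA i j z hz) (C := |b z| + 1 + 1) ?_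
  filter_upwards [eventually_nhdsNE_of_codiscreteWithin h hz,
    hbz.eventually_lt_const (lt_add_one (b z))] with w hw1 hw2
  have h1 := norm_sq_le_re_trace (A w) i j
  have h2 := le_abs_self (b z)
  nlinarith [norm_nonneg (A w i j), hw1.1, abs_nonneg (b z)]

/-- The polarization identity for the entries of a matrix. -/
lemma apply_eq_polarization [Fintype ι] [DecidableEq ι] (M : Matrix ι ι ℂ) (i j : ι)
    {Q : (ι → ℂ) → ℂ} (hQ : ∀ v, Q v = star v ⬝ᵥ (M *ᵥ v)) :
    M i j = (1 / 4) * (Q (Pi.single i 1 + Pi.single j 1) - Q (Pi.single i 1 - Pi.single j 1)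
      - Complex.I * Q (Pi.single i 1 + Complex.I • Pi.single j 1)
      + Complex.I * Q (Pi.single i 1 - Complex.I • Pi.single j 1)) := by
  simp only [hQ, Matrix.mulVec_add, Matrix.mulVec_sub, Matrix.mulVec_smul, star_add, star_sub,
    star_smul, add_dotProduct, sub_dotProduct, dotProduct_add, dotProduct_sub, smul_dotProduct,
    dotProduct_smul, smul_eq_mul, Complex.star_def, Complex.conj_I, Pi.star_single, star_one,
    Matrix.mulVec_single_one, single_one_dotProduct, Matrix.col_apply]
  linear_combination (M i j / 2 - M j i / 2) * Complex.I_sq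

/-- A meromorphic matrix function with nonnegative real part has only removable singularities. -/
lemma MeroUpper.exists_holUpper_of_posSemidef [Fintype ι] [DecidableEq ι] {A : ℂ → Matrix ι ι ℂ}
    (hA : MeroUpper A)
    (h : ∀ᶠ z in codiscreteWithin upperPlane, (A z + (A z)ᴴ).PosSemidef) :
    ∃ f, HolUpper f ∧ A =ᶠ[codiscreteWithin upperPlane] f := by
  refine hA.exists_holUpper fun z hz i j => ?_
  -- Only the quadratic forms have a sign, so the scalar result is applied to them; polarization
  -- then recovers the entries.
  have hQ : ∀ v : ι → ℂ, ∃ c, Tendsto (fun w => star v ⬝ᵥ (A w *ᵥ v)) (𝓝[≠] z) (𝓝 c) := by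
    intro v
    refine exists_tendsto_of_re_nonneg ?_ ?_
    · simp only [dotProduct, Matrix.mulVec]
      exact MeromorphicAt.fun_sum fun a _ => (MeromorphicAt.const _ _).mul
        (MeromorphicAt.fun_sum fun b _ => (hA a b z hz).mul (MeromorphicAt.const _ _))
    · filter_upwards [eventually_nhdsNE_of_codiscreteWithin h hz] with w hw
      have h1 := hw.1.dotProduct_mulVec_nonneg v
      have h2 : star v ⬝ᵥ ((A w)ᴴ *ᵥ v) = star (star v ⬝ᵥ (A w *ᵥ v)) := by
        rw [Matrix.star_dotProduct, Matrix.star_mulVec, ← Matrix.dotProduct_mulVec,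
          Matrix.conjTranspose_conjTranspose]
      rw [Matrix.add_mulVec, dotProduct_add, h2] at h1
      have h3 := (Complex.nonneg_iff.1 h1).1
      simp at h3
      linarith
  choose c hc using hQ
  rw [funext fun w => apply_eq_polarization (A w) i j
    (Q := fun v => star v ⬝ᵥ (A w *ᵥ v)) fun _ => rfl]
  exact ⟨_, ((((hc _).sub (hc _)).sub ((hc _).const_mul _)).add ((hc _).const_mul _)).const_mul _⟩

lemma isClosed_posSemidef [Fintype ι] : IsClosed {M : Matrix ι ι ℂ | M.PosSemidef} := by
  simp only [Matrix.posSemidef_iff_dotProduct_mulVec, Set.ofPred_and, Set.ofPred_forall]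
  refine IsClosed.inter ?_ (isClosed_iInter fun v => ?_)
  · exact isClosed_eq (by fun_prop) continuous_id
  · exact isClosed_le continuous_const
      (continuous_const.dotProduct (continuous_id.matrix_mulVec continuous_const))

end Removable

end DeBranges

/-! ### Block algebra of the form `j - U* 𝒥 U` -/

namespace DeBranges

variable {n : ℕ}

lemma conjTranspose_scriptJ : (scriptJ n)ᴴ = scriptJ n := by
  simp [scriptJ, Matrix.fromBlocks_conjTranspose]

lemma scriptJ_mul_self : scriptJ n * scriptJ n = 1 := by
  simp [scriptJ, Matrix.fromBlocks_multiply, smul_smul]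

lemma matM_conj_scriptJ : (matM n)ᴴ * scriptJ n * matM n = smallJ n := by
  have h : ((1 / Real.sqrt 2 : ℝ) : ℂ) * ((1 / Real.sqrt 2 : ℝ) : ℂ) = 1 / 2 := by
    rw [← Complex.ofReal_mul, div_mul_div_comm, Real.mul_self_sqrt (by norm_num)]
    norm_num
  rw [matM, Matrix.conjTranspose_smul, Matrix.smul_mul, Matrix.smul_mul, Matrix.mul_smul, smul_smul,
    Complex.star_def, Complex.conj_ofReal, h]
  simp [scriptJ, smallJ, Matrix.fromBlocks_conjTranspose, Matrix.fromBlocks_multiply, smul_smul,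
    Matrix.fromBlocks_smul, ← two_smul ℂ]

lemma matU_posSemidef {A : ℂ → Matrix (Fin n ⊕ Fin n) (Fin n ⊕ Fin n) ℂ} {z : ℂ}
    (h : (scriptJ n - (A z)ᴴ * scriptJ n * A z).PosSemidef) :
    (smallJ n - (matU A z)ᴴ * scriptJ n * matU A z).PosSemidef := by
  have := h.conjTranspose_mul_mul_same (matM n)
  convert this using 1
  rw [← matM_conj_scriptJ, matU, Matrix.conjTranspose_mul]
  simp only [Matrix.mul_sub, Matrix.sub_mul, Matrix.mul_assoc]

section Blocks

variable {U : Matrix (Fin n ⊕ Fin n) (Fin n ⊕ Fin n) ℂ}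

/-- The form `j - U^* J U` evaluated on a block column. -/
lemma posSemidef_block_column {κ : Type*} [Fintype κ]
    (hU : (smallJ n - Uᴴ * scriptJ n * U).PosSemidef) (p q : Matrix (Fin n) κ ℂ) :
    (pᴴ * p - qᴴ * q - Complex.I •
      ((U.toBlocks₁₁ * p + U.toBlocks₁₂ * q)ᴴ * (U.toBlocks₂₁ * p + U.toBlocks₂₂ * q) -
        (U.toBlocks₂₁ * p + U.toBlocks₂₂ * q)ᴴ *
          (U.toBlocks₁₁ * p + U.toBlocks₁₂ * q))).PosSemidef := by
  have h := hU.conjTranspose_mul_mul_same (Matrix.fromRows p q)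
  have hUT : U * Matrix.fromRows p q = Matrix.fromRows
      (U.toBlocks₁₁ * p + U.toBlocks₁₂ * q) (U.toBlocks₂₁ * p + U.toBlocks₂₂ * q) := by
    conv_lhs => rw [← Matrix.fromBlocks_toBlocks U]
    rw [Matrix.fromBlocks_mul_fromRows]
  have h2 : (Matrix.fromRows p q)ᴴ * (smallJ n - Uᴴ * scriptJ n * U) * Matrix.fromRows p q =
      (Matrix.fromRows p q)ᴴ * (smallJ n * Matrix.fromRows p q) -
        (U * Matrix.fromRows p q)ᴴ * (scriptJ n * (U * Matrix.fromRows p q)) := by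
    simp only [Matrix.mul_sub, Matrix.sub_mul, Matrix.mul_assoc, Matrix.conjTranspose_mul]
  rw [h2, hUT, smallJ, scriptJ, Matrix.fromBlocks_mul_fromRows, Matrix.fromBlocks_mul_fromRows,
    Matrix.conjTranspose_fromRows_eq_fromCols_conjTranspose,
    Matrix.conjTranspose_fromRows_eq_fromCols_conjTranspose, Matrix.fromCols_mul_fromRows,
    Matrix.fromCols_mul_fromRows] at h
  convert h using 1
  simp only [Matrix.one_mul, Matrix.zero_mul, add_zero, zero_add, Matrix.neg_mul, Matrix.smul_mul,
    Matrix.mul_smul, Matrix.mul_neg, smul_sub, neg_smul]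
  abel

/-- On a column `(0, v)` with `u₁₂ v = 0` the `𝒥`-term vanishes and the form reduces to `-v* v`. -/
lemma isUnit_toBlocks₁₂ (hU : (smallJ n - Uᴴ * scriptJ n * U).PosSemidef) :
    IsUnit U.toBlocks₁₂ := by
  rw [← Matrix.mulVec_injective_iff_isUnit]
  refine (injective_iff_map_eq_zero U.toBlocks₁₂.mulVecLin).2 fun v hv => ?_
  have hv' : U.toBlocks₁₂ * Matrix.replicateCol Unit v = 0 := by
    rw [← Matrix.replicateCol_mulVec]
    simpa using hv
  have h := posSemidef_block_column hU 0 (Matrix.replicateCol Unit v)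
  simp only [Matrix.mul_zero, zero_add, hv', Matrix.conjTranspose_zero, Matrix.zero_mul, sub_zero,
    smul_zero, zero_sub] at h
  have h0 := h.diag_nonneg (i := ())
  have h1 : (Matrix.replicateCol Unit v)ᴴ * Matrix.replicateCol Unit v =
      fun _ _ => star v ⬝ᵥ v := by
    ext i j; simp [Matrix.mul_apply, dotProduct]
  rw [Matrix.neg_apply, h1] at h0
  have h3 : star v ⬝ᵥ v ≤ 0 := neg_nonneg.1 h0
  exact dotProduct_star_self_eq_zero.1 (le_antisymm h3 (dotProduct_star_self_nonneg v))

lemma posSemidef_caratheodory_form (hU : (smallJ n - Uᴴ * scriptJ n * U).PosSemidef) :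
    (-Complex.I • (U.toBlocks₂₂ * U.toBlocks₁₂⁻¹) +
      (-Complex.I • (U.toBlocks₂₂ * U.toBlocks₁₂⁻¹))ᴴ -
        (U.toBlocks₁₂⁻¹)ᴴ * U.toBlocks₁₂⁻¹).PosSemidef := by
  have hb := (Matrix.isUnit_iff_isUnit_det _).1 (isUnit_toBlocks₁₂ hU)
  have h := posSemidef_block_column hU 0 U.toBlocks₁₂⁻¹
  simp only [Matrix.mul_zero, zero_add, Matrix.mul_nonsing_inv _ hb, Matrix.conjTranspose_one,
    Matrix.one_mul, Matrix.mul_one, Matrix.conjTranspose_zero, zero_sub] at h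
  convert h using 1
  simp only [Matrix.conjTranspose_smul, Matrix.conjTranspose_neg, Complex.star_def, Complex.conj_I,
    smul_sub, neg_smul, neg_neg]
  abel

lemma posSemidef_schur_form (hU : (smallJ n - Uᴴ * scriptJ n * U).PosSemidef) :
    (1 - (U.toBlocks₁₂⁻¹ * U.toBlocks₁₁)ᴴ * (U.toBlocks₁₂⁻¹ * U.toBlocks₁₁)).PosSemidef := by
  have hb := (Matrix.isUnit_iff_isUnit_det _).1 (isUnit_toBlocks₁₂ hU)
  have h := posSemidef_block_column hU 1 (-(U.toBlocks₁₂⁻¹ * U.toBlocks₁₁))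
  have h0 : U.toBlocks₁₁ * 1 + U.toBlocks₁₂ * -(U.toBlocks₁₂⁻¹ * U.toBlocks₁₁) = 0 := by
    rw [Matrix.mul_neg, Matrix.mul_nonsing_inv_cancel_left _ _ hb, Matrix.mul_one, add_neg_cancel]
  rw [h0] at h
  simpa using h

/-- The Schur complement `i (u₂₁ - u₂₂ u₁₂⁻¹ u₁₁)`. -/
noncomputable def schurComplement (U : Matrix (Fin n ⊕ Fin n) (Fin n ⊕ Fin n) ℂ) : Matrix (Fin n) (Fin n) ℂ :=
  Complex.I • (U.toBlocks₂₁ - U.toBlocks₂₂ * U.toBlocks₁₂⁻¹ * U.toBlocks₁₁)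

/-- This becomes the `H²` bound for `{u₁₁^#}⁻¹`. With first entry `X*`, the `𝒥`-term contributes `-2
X X*`, which outweighs `p* p = X X*`; the leftover `-q* q` is discarded. -/
lemma posSemidef_schurComplement_form (hU : (smallJ n - Uᴴ * scriptJ n * U).PosSemidef) :
    (-Complex.I • (U.toBlocks₂₂ * U.toBlocks₁₂⁻¹) +
      (-Complex.I • (U.toBlocks₂₂ * U.toBlocks₁₂⁻¹))ᴴ -
        schurComplement U * (schurComplement U)ᴴ).PosSemidef := by
  have hb := (Matrix.isUnit_iff_isUnit_det _).1 (isUnit_toBlocks₁₂ hU)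
  set X := schurComplement U with hX
  -- The solution of `u₁₁ X* + u₁₂ q = 1`.
  set q := U.toBlocks₁₂⁻¹ * (1 - U.toBlocks₁₁ * Xᴴ) with hq
  have h := posSemidef_block_column hU Xᴴ q
  have hr : U.toBlocks₁₁ * Xᴴ + U.toBlocks₁₂ * q = 1 := by
    rw [hq, Matrix.mul_nonsing_inv_cancel_left _ _ hb, add_sub_cancel]
  have hs : U.toBlocks₂₁ * Xᴴ + U.toBlocks₂₂ * q =
      U.toBlocks₂₂ * U.toBlocks₁₂⁻¹ - Complex.I • (X * Xᴴ) := by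
    have h1 : Complex.I • X = -(U.toBlocks₂₁ - U.toBlocks₂₂ * U.toBlocks₁₂⁻¹ * U.toBlocks₁₁) := by
      rw [hX, schurComplement, smul_smul, Complex.I_mul_I, neg_one_smul]
    rw [← Matrix.smul_mul, h1, hq]
    simp only [Matrix.mul_sub, Matrix.sub_mul, Matrix.neg_mul, Matrix.mul_one, Matrix.mul_assoc]
    abel
  rw [hr, hs] at h
  have h3 := h.add (Matrix.posSemidef_conjTranspose_mul_self q)
  convert h3 using 1
  simp only [Matrix.conjTranspose_sub, Matrix.conjTranspose_smul, Matrix.conjTranspose_mul,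
    Matrix.conjTranspose_conjTranspose, Matrix.conjTranspose_one, Matrix.one_mul, Matrix.mul_one,
    Matrix.conjTranspose_neg, Complex.star_def, Complex.conj_I, smul_sub, neg_smul, neg_neg,
    smul_smul, Complex.I_mul_I, one_smul, sub_neg_eq_add, smul_add]
  abel

/-! ### Consequences of `V 𝒥 U = j`, to be used with `V = U^#` or `V = U*` -/

section Dual

variable {V : Matrix (Fin n ⊕ Fin n) (Fin n ⊕ Fin n) ℂ}

lemma dual_blocks (h : V * scriptJ n * U = smallJ n) :
    Complex.I • (V.toBlocks₁₁ * U.toBlocks₂₁ - V.toBlocks₁₂ * U.toBlocks₁₁) = 1 ∧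
    V.toBlocks₁₁ * U.toBlocks₂₂ = V.toBlocks₁₂ * U.toBlocks₁₂ ∧
    V.toBlocks₂₁ * U.toBlocks₂₁ = V.toBlocks₂₂ * U.toBlocks₁₁ ∧
    Complex.I • (V.toBlocks₂₁ * U.toBlocks₂₂ - V.toBlocks₂₂ * U.toBlocks₁₂) = -1 := by
  rw [← Matrix.fromBlocks_toBlocks V, ← Matrix.fromBlocks_toBlocks U, scriptJ, smallJ,
    Matrix.fromBlocks_multiply, Matrix.fromBlocks_multiply, Matrix.fromBlocks_inj] at h
  simp only [Matrix.mul_zero, zero_add, add_zero, Matrix.mul_smul, Matrix.mul_one, Matrix.smul_mul,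
    neg_smul, Matrix.mul_neg, Matrix.neg_mul] at h
  obtain ⟨h1, h2, h3, h4⟩ := h
  have hI : Function.Injective fun M : Matrix (Fin n) (Fin n) ℂ => Complex.I • M :=
    smul_right_injective _ Complex.I_ne_zero
  refine ⟨?_, hI ?_, hI ?_, ?_⟩
  · rw [smul_sub, ← h1]; abel
  · exact (neg_add_eq_zero.1 h2).symm
  · exact (neg_add_eq_zero.1 h3).symm
  · rw [smul_sub, ← h4]; abel

/-- The off-diagonal identity `v₁₁ u₂₂ = v₁₂ u₁₂` eliminates `v₁₂` from the first diagonal one. -/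
lemma toBlocks₁₁_mul_schurComplement (h : V * scriptJ n * U = smallJ n)
    (hb : IsUnit U.toBlocks₁₂) : V.toBlocks₁₁ * schurComplement U = 1 := by
  rw [Matrix.isUnit_iff_isUnit_det] at hb
  obtain ⟨h1, h2, -, -⟩ := dual_blocks h
  rw [schurComplement, Matrix.mul_smul, Matrix.mul_sub, ← Matrix.mul_assoc, ← Matrix.mul_assoc, h2,
    Matrix.mul_nonsing_inv_cancel_right _ _ hb, h1]

lemma isUnit_dual_toBlocks₁₁ (h : V * scriptJ n * U = smallJ n) (hb : IsUnit U.toBlocks₁₂) :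
    IsUnit V.toBlocks₁₁ :=
  IsUnit.of_mul_eq_one _ (toBlocks₁₁_mul_schurComplement h hb)

lemma dual_toBlocks₁₁_inv (h : V * scriptJ n * U = smallJ n) (hb : IsUnit U.toBlocks₁₂) :
    V.toBlocks₁₁⁻¹ = schurComplement U :=
  Matrix.inv_eq_right_inv (toBlocks₁₁_mul_schurComplement h hb)

lemma inv_mul_eq_mul_inv_dual (h : V * scriptJ n * U = smallJ n) (hb : IsUnit U.toBlocks₁₂) :
    U.toBlocks₁₂⁻¹ * U.toBlocks₁₁ = V.toBlocks₂₁ * V.toBlocks₁₁⁻¹ := by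
  rw [dual_toBlocks₁₁_inv h hb]
  rw [Matrix.isUnit_iff_isUnit_det] at hb
  obtain ⟨-, -, h3, h4⟩ := dual_blocks h
  have h5 : Complex.I • (V.toBlocks₂₁ * (U.toBlocks₂₂ * U.toBlocks₁₂⁻¹) - V.toBlocks₂₂) =
      -U.toBlocks₁₂⁻¹ := by
    have := congrArg (· * U.toBlocks₁₂⁻¹) h4
    simpa [Matrix.sub_mul, Matrix.mul_assoc, Matrix.mul_nonsing_inv _ hb] using this
  rw [schurComplement, Matrix.mul_smul, Matrix.mul_sub, h3, ← Matrix.mul_assoc, ← Matrix.sub_mul,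
    ← neg_sub, Matrix.neg_mul, smul_neg, ← Matrix.smul_mul, h5, Matrix.neg_mul, neg_neg]

end Dual

/-- `u₁₂⁻¹ u₁₁` is unitary when `U^* J U = j`. -/
lemma inv_mul_mul_conjTranspose_eq_one (h : Uᴴ * scriptJ n * U = smallJ n) :
    (U.toBlocks₁₂⁻¹ * U.toBlocks₁₁) * (U.toBlocks₁₂⁻¹ * U.toBlocks₁₁)ᴴ = 1 := by
  have hb : IsUnit U.toBlocks₁₂ := isUnit_toBlocks₁₂ (by rw [h, sub_self]; exact .zero)
  -- Taking `V = U*` gives `χ = u₁₂* u₁₁⁻*`, which cancels against `χ* = u₁₁* u₁₂⁻*`.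
  have ha := isUnit_dual_toBlocks₁₁ h hb
  have hχ := inv_mul_eq_mul_inv_dual h hb
  rw [Matrix.isUnit_iff_isUnit_det] at ha hb
  have h11 : Uᴴ.toBlocks₁₁ = U.toBlocks₁₁ᴴ := rfl
  have h21 : Uᴴ.toBlocks₂₁ = U.toBlocks₁₂ᴴ := rfl
  rw [Matrix.conjTranspose_mul, ← Matrix.mul_assoc, hχ, ← h11,
    Matrix.nonsing_inv_mul_cancel_right _ _ ha, h21, ← Matrix.conjTranspose_mul,
    Matrix.nonsing_inv_mul _ hb, Matrix.conjTranspose_one]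

end Blocks

/-- `U^# J U = j` for the continuation of `A` by symmetry. -/
lemma sharp_continued_mul {A : ℂ → Matrix (Fin n ⊕ Fin n) (Fin n ⊕ Fin n) ℂ} {z : ℂ}
    (hz : z ∈ upperPlane) (hA : IsUnit (A z)) :
    sharp (matU (continued (scriptJ n) A)) z * scriptJ n * matU A z = smallJ n := by
  have hz' : (starRingEnd ℂ z).im < 0 := by simpa [upperPlane] using hz
  rw [Matrix.isUnit_iff_isUnit_det] at hA
  have h1 : sharp (matU (continued (scriptJ n) A)) z =
      (matM n)ᴴ * (scriptJ n * (A z)⁻¹ * scriptJ n) := by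
    simp only [sharp, matU, continued, if_pos hz', starRingEnd_self_apply,
      Matrix.conjTranspose_mul, conjTranspose_scriptJ, Matrix.conjTranspose_nonsing_inv,
      Matrix.conjTranspose_conjTranspose, Matrix.mul_assoc]
  have h2 : scriptJ n * (A z)⁻¹ * scriptJ n * scriptJ n * A z = scriptJ n := by
    rw [Matrix.mul_assoc _ (scriptJ n) (scriptJ n), scriptJ_mul_self, Matrix.mul_one,
      Matrix.nonsing_inv_mul_cancel_right _ _ hA]
  calc _ = (matM n)ᴴ * (scriptJ n * (A z)⁻¹ * scriptJ n * scriptJ n * A z) * matM n := by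
        rw [h1, matU]; simp only [Matrix.mul_assoc]
    _ = _ := by rw [h2, matM_conj_scriptJ]

end DeBranges

namespace DeBranges

variable {n : ℕ}

/-! ### The class `P(𝒥)` -/

section ClassP

variable {A : ℂ → Matrix (Fin n ⊕ Fin n) (Fin n ⊕ Fin n) ℂ}

lemma MeroUpper.matU (hA : MeroUpper A) : MeroUpper (matU A) := hA.mul (MeroUpper.const _)

lemma MeroUpper.u11 (hA : MeroUpper A) : MeroUpper (u11 A) := fun _ _ => hA.matU _ _

lemma MeroUpper.u12 (hA : MeroUpper A) : MeroUpper (u12 A) := fun _ _ => hA.matU _ _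

lemma MeroUpper.u22 (hA : MeroUpper A) : MeroUpper (u22 A) := fun _ _ => hA.matU _ _

lemma MeroUpper.schurComplement (hA : MeroUpper A) :
    MeroUpper fun z => schurComplement (DeBranges.matU A z) := by
  have h21 : MeroUpper fun z => (DeBranges.matU A z).toBlocks₂₁ := fun _ _ => hA.matU _ _
  exact (h21.sub ((hA.u22.mul hA.u12.inv).mul hA.u11)).const_smul _

lemma eventually_matU_posSemidef (hA : A ∈ classP (scriptJ n)) :
    ∀ᶠ z in codiscreteWithin upperPlane,
      (smallJ n - (matU A z)ᴴ * scriptJ n * matU A z).PosSemidef := by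
  filter_upwards [hA.1.eventually_holAt] with z hz
  exact matU_posSemidef (hA.2 z hz.1 hz.2)

lemma exists_caratheodory (hA : A ∈ classP (scriptJ n)) :
    BelongsTo (fun z => -Complex.I • (u22 A z * (u12 A z)⁻¹)) (caratheodory n) := by
  have hpos : ∀ᶠ z in codiscreteWithin upperPlane, (-Complex.I • (u22 A z * (u12 A z)⁻¹) +
      (-Complex.I • (u22 A z * (u12 A z)⁻¹))ᴴ).PosSemidef := by
    filter_upwards [eventually_matU_posSemidef hA] with z hz
    have := (posSemidef_caratheodory_form hz).add
      (Matrix.posSemidef_conjTranspose_mul_self (matU A z).toBlocks₁₂⁻¹)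
    rwa [sub_add_cancel] at this
  obtain ⟨Φ, hΦ, heq⟩ :=
    ((hA.1.u22.mul hA.1.u12.inv).const_smul (-Complex.I)).exists_holUpper_of_posSemidef hpos
  refine ⟨Φ, ⟨hΦ, ?_⟩, heq⟩
  have hcont : ContinuousOn (fun z => (1 / 2 : ℂ) • (Φ z + (Φ z)ᴴ)) upperPlane := by
    have hc : Continuous fun M : Matrix (Fin n) (Fin n) ℂ => (1 / 2 : ℂ) • (M + Mᴴ) := by fun_prop
    exact hc.comp_continuousOn hΦ.continuousOn
  refine forall_mem_of_codiscreteWithin hcont isClosed_posSemidef ?_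
  filter_upwards [heq, hpos] with z h1 h2
  rw [← h1]
  refine h2.smul ?_
  rw [Complex.nonneg_iff]
  norm_num

lemma norm_toEuclideanCLM_le_one {M : Matrix (Fin n) (Fin n) ℂ} (h : (1 - Mᴴ * M).PosSemidef) :
    ‖Matrix.toEuclideanCLM (n := Fin n) (𝕜 := ℂ) M‖ ≤ 1 := by
  have hn : ∀ y : EuclideanSpace ℂ (Fin n), ((‖y‖ ^ 2 : ℝ) : ℂ) = star y.ofLp ⬝ᵥ y.ofLp := by
    intro y
    rw [EuclideanSpace.norm_sq_eq]
    simp [dotProduct, Complex.conj_mul']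
  refine ContinuousLinearMap.opNorm_le_bound _ zero_le_one fun x => ?_
  rw [one_mul]
  refine le_of_sq_le_sq ?_ (norm_nonneg _)
  have h1 := h.dotProduct_mulVec_nonneg x.ofLp
  have h2 : (Matrix.toEuclideanCLM (n := Fin n) (𝕜 := ℂ) M x).ofLp = M *ᵥ x.ofLp := rfl
  rw [Matrix.sub_mulVec, dotProduct_sub, Matrix.one_mulVec, ← Matrix.mulVec_mulVec,
    Matrix.dotProduct_mulVec, ← Matrix.star_mulVec, ← h2, ← hn, ← hn, ← Complex.ofReal_sub,
    Complex.zero_le_real] at h1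
  linarith

lemma exists_schur (hA : A ∈ classP (scriptJ n)) :
    BelongsTo (fun z => (u12 A z)⁻¹ * u11 A z) (schur n) := by
  have hpos : ∀ᶠ z in codiscreteWithin upperPlane,
      (1 - ((u12 A z)⁻¹ * u11 A z)ᴴ * ((u12 A z)⁻¹ * u11 A z)).PosSemidef := by
    filter_upwards [eventually_matU_posSemidef hA] with z hz using posSemidef_schur_form hz
  obtain ⟨χ, hχ, heq⟩ := (hA.1.u12.inv.mul hA.1.u11).exists_holUpper_of_trace_le
    (b := fun _ => n) continuousOn_const (by
      filter_upwards [hpos] with z hz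
      have := (Complex.nonneg_iff.1 hz.trace_nonneg).1
      simpa [Matrix.trace_sub] using this)
  refine ⟨χ, ⟨hχ, fun z hz => norm_toEuclideanCLM_le_one ?_⟩, heq⟩
  have hcont : ContinuousOn (fun z => 1 - (χ z)ᴴ * χ z) upperPlane := by
    have hc : Continuous fun M : Matrix (Fin n) (Fin n) ℂ => 1 - Mᴴ * M := by fun_prop
    exact hc.comp_continuousOn hχ.continuousOn
  refine forall_mem_of_codiscreteWithin hcont isClosed_posSemidef ?_ z hz
  filter_upwards [heq, hpos] with z h1 h2
  rwa [← h1]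

/-- The scalar majorant is `φ = tr Φ`. Its continuity removes the singularities of `G`, and the
bound then extends to every point. -/
lemma belongsTo_hardyTwo {G Φ : ℂ → Matrix (Fin n) (Fin n) ℂ} (hG : MeroUpper G)
    (hΦ : Φ ∈ caratheodory n)
    (h : ∀ᶠ z in codiscreteWithin upperPlane, ((G z)ᴴ * G z).trace.re ≤ (Φ z + (Φ z)ᴴ).trace.re) :
    BelongsTo (fun z => (rho Complex.I z)⁻¹ • G z) (hardyTwo n) := by
  have htr : ∀ z, (Φ z + (Φ z)ᴴ).trace.re = 2 * (Φ z).trace.re := fun z => by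
    rw [Matrix.trace_add, Matrix.trace_conjTranspose, Complex.add_re, Complex.star_def,
      Complex.conj_re, two_mul]
  simp only [htr] at h
  have hφ : DifferentiableOn ℂ (fun z => (Φ z).trace) upperPlane := by
    simp only [Matrix.trace, Matrix.diag]
    exact DifferentiableOn.fun_sum fun i _ => hΦ.1 i i
  have hcont : ContinuousOn (fun z => 2 * (Φ z).trace.re) upperPlane :=
    continuousOn_const.mul (Complex.continuous_re.comp_continuousOn hφ.continuousOn)
  obtain ⟨g, hg, heq⟩ := hG.exists_holUpper_of_trace_le hcont h
  refine ⟨_, smul_mem_hardyTwo hg hφ (fun z hz => ?_) ?_, ?_⟩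
  · have := (Complex.nonneg_iff.1 (hΦ.2 z hz).trace_nonneg).1
    rw [Matrix.trace_smul, smul_eq_mul, show (1 / 2 : ℂ) = ((1 / 2 : ℝ) : ℂ) by simp,
      Complex.re_ofReal_mul, htr] at this
    linarith
  · have hc : ContinuousOn (fun z => 2 * (Φ z).trace.re - ((g z)ᴴ * g z).trace.re) upperPlane := by
      refine hcont.sub (Complex.continuous_re.comp_continuousOn ?_)
      have hc : Continuous fun M : Matrix (Fin n) (Fin n) ℂ => (Mᴴ * M).trace := by fun_prop
      exact hc.comp_continuousOn hg.continuousOn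
    refine fun z hz => sub_nonneg.1 (forall_mem_of_codiscreteWithin hc isClosed_Ici ?_ z hz)
    filter_upwards [heq, h] with z h1 h2
    rw [← h1]
    exact sub_nonneg.2 h2
  · filter_upwards [heq] with z hz
    rw [hz]

lemma inv_u12_belongsTo_hardyTwo (hA : A ∈ classP (scriptJ n)) :
    BelongsTo (fun z => (rho Complex.I z)⁻¹ • (u12 A z)⁻¹) (hardyTwo n) := by
  obtain ⟨Φ, hΦ, heq⟩ := exists_caratheodory hA
  refine belongsTo_hardyTwo hA.1.u12.inv hΦ ?_
  filter_upwards [heq, eventually_matU_posSemidef hA] with z h1 h2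
  have := (Complex.nonneg_iff.1 (posSemidef_caratheodory_form h2).trace_nonneg).1
  rw [Matrix.trace_sub, Complex.sub_re, sub_nonneg] at this
  rw [← h1]
  exact this

lemma schurComplement_belongsTo_hardyTwo (hA : A ∈ classP (scriptJ n)) :
    BelongsTo (fun z => (rho Complex.I z)⁻¹ • (-Complex.I • schurComplement (matU A z)))
      (hardyTwo n) := by
  obtain ⟨Φ, hΦ, heq⟩ := exists_caratheodory hA
  refine belongsTo_hardyTwo (hA.1.schurComplement.const_smul _) hΦ ?_
  filter_upwards [heq, eventually_matU_posSemidef hA] with z h1 h2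
  have := (Complex.nonneg_iff.1 (posSemidef_schurComplement_form h2).trace_nonneg).1
  -- The form bounds `X X*`; under the trace this is the same as `X* X`.
  rw [Matrix.trace_sub, Complex.sub_re, sub_nonneg, Matrix.trace_mul_comm] at this
  rw [← h1, re_trace_conjTranspose_smul]
  simp only [norm_neg, Complex.norm_I, one_pow, one_mul]
  exact this

end ClassP

/-! ### Nontangential limits along codiscrete sets -/

section Boundary

lemma isOpen_angle (x α : ℝ) : IsOpen (angle x α) :=
  (isOpen_lt continuous_const Complex.continuous_im).inter
    (isOpen_lt (Complex.continuous_re.sub continuous_const).abs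
      (continuous_const.mul Complex.continuous_im))

lemma angle_subset_upperPlane (x α : ℝ) : angle x α ⊆ upperPlane := fun _ hz => hz.1

lemma mem_closure_angle (x : ℝ) {α : ℝ} (hα : 0 < α) : (x : ℂ) ∈ closure (angle x α) := by
  have h : Tendsto (fun t : ℝ => (x : ℂ) + t * Complex.I) (𝓝[>] 0) (𝓝 (x + (0 : ℝ) * Complex.I)) :=
    (Continuous.tendsto (by fun_prop) 0).mono_left nhdsWithin_le_nhds
  rw [Complex.ofReal_zero, zero_mul, add_zero] at h
  refine mem_closure_of_tendsto h ?_
  filter_upwards [self_mem_nhdsWithin] with t ht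
  have ht' : 0 < t := ht
  exact ⟨by simpa using ht', by simpa using mul_pos hα ht'⟩

/-- A codiscrete set is dense in every open subset of the half plane. -/
lemma subset_closure_of_codiscreteWithin {O S : Set ℂ} (hO : IsOpen O) (hOU : O ⊆ upperPlane)
    (hS : ∀ᶠ z in codiscreteWithin upperPlane, z ∈ S) : O ⊆ closure (O ∩ S) := by
  intro z hz
  have h : ∀ᶠ w in 𝓝[≠] z, w ∈ O ∩ S := by
    filter_upwards [nhdsWithin_le_nhds (hO.mem_nhds hz),
      eventually_nhdsNE_of_codiscreteWithin hS (hOU hz)] with w h1 h2 using ⟨h1, h2.1⟩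
  exact mem_closure_of_tendsto (tendsto_id.mono_left nhdsWithin_le_nhds) h

lemma neBot_nhdsWithin_angle (x : ℝ) {α : ℝ} (hα : 0 < α) {S : Set ℂ}
    (hS : ∀ᶠ z in codiscreteWithin upperPlane, z ∈ S) :
    (𝓝[angle x α ∩ S] (x : ℂ)).NeBot := by
  rw [← mem_closure_iff_nhdsWithin_neBot]
  exact closure_minimal (subset_closure_of_codiscreteWithin (isOpen_angle x α)
    (angle_subset_upperPlane x α) hS) isClosed_closure (mem_closure_angle x hα)

/-- For a function holomorphic in the half plane, boundary values may be computed along a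
codiscrete set. -/
lemma HolUpper.hasBoundaryValue {ι κ : Type*} {f : ℂ → Matrix ι κ ℂ} (hf : HolUpper f) {x : ℝ}
    {L : Matrix ι κ ℂ} {S : Set ℂ} (hS : ∀ᶠ z in codiscreteWithin upperPlane, z ∈ S)
    (h : ∀ α : ℝ, 0 < α → Tendsto f (𝓝[angle x α ∩ S] (x : ℂ)) (𝓝 L)) :
    HasBoundaryValue f x L := by
  intro α hα
  -- With `K` closed, `f ∈ K` on the dense part in `S` passes to the whole angle by continuity.
  refine (closed_nhds_basis L).tendsto_right_iff.2 fun K hK => ?_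
  obtain ⟨O, hO, hxO, hOK⟩ := mem_nhdsWithin.1 (h α hα hK.1)
  refine mem_nhdsWithin.2 ⟨O, hO, hxO, fun z hz => ?_⟩
  have hzU : z ∈ upperPlane := hz.2.1.1
  have hcl := subset_closure_of_codiscreteWithin (hO.inter (isOpen_angle x α))
    (fun w hw => hw.2.1) hS ⟨hz.1, hz.2.1⟩
  have hc : ContinuousWithinAt f ((O ∩ angle x α) ∩ S) z :=
    (hf.continuousOn.continuousAt (isOpen_upperPlane.mem_nhds hzU)).continuousWithinAt
  have hmaps : Set.MapsTo f ((O ∩ angle x α) ∩ S) K := fun w hw => hOK ⟨hw.1.1, hw.1.2, hw.2⟩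
  exact hK.2.closure_subset (hc.mem_closure hcl hmaps)

end Boundary

/-! ### The class `U(𝒥)` and the continuation to the lower half plane -/

section ClassU

variable {A : ℂ → Matrix (Fin n ⊕ Fin n) (Fin n ⊕ Fin n) ℂ}

/-- If `det A` vanished identically, so would `det L` for a boundary value `L`, contradicting `L* 𝒥
L = 𝒥` and `𝒥² = 1`. One boundary point suffices, the half plane being connected. -/
lemma eventually_isUnit (hA : A ∈ classU (scriptJ n)) :
    ∀ᶠ z in codiscreteWithin upperPlane, IsUnit (A z) := by
  have hmero := hA.1.1
  have hdet := hmero.det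
  suffices h : ∃ u ∈ upperPlane, meromorphicOrderAt (fun z => (A z).det) u ≠ ⊤ by
    obtain ⟨u, hu, hne⟩ := h
    have := hdet.eventually_codiscreteWithin_apply_ne_zero fun v hv =>
      hdet.meromorphicOrderAt_ne_top_of_isPreconnected isPreconnected_upperPlane hu hv hne
    filter_upwards [this] with z hz
    exact (Matrix.isUnit_iff_isUnit_det _).2 hz.isUnit
  by_contra! hall
  have hzero : ∀ z ∈ upperPlane, HolAt A z → (A z).det = 0 := by
    intro z hz hhol
    have h1 : ContinuousAt (fun z => (A z).det) z :=
      (continuous_id.matrix_det.tendsto (A z)).comp hhol.continuousAt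
    have h2 := meromorphicOrderAt_eq_top_iff.1 (hall z hz)
    have h3 : Tendsto (fun z => (A z).det) (𝓝[≠] z) (𝓝 0) :=
      tendsto_const_nhds.congr' (h2.mono fun w hw => hw.symm)
    exact tendsto_nhds_unique (h1.tendsto.mono_left nhdsWithin_le_nhds) h3
  obtain ⟨x, L, hL, hLJ⟩ := hA.2.exists
  have hne : (𝓝[angle x 1 ∩ {z | HolAt A z}] (x : ℂ)).NeBot :=
    neBot_nhdsWithin_angle x one_pos (hmero.eventually_holAt.mono fun _ hz => hz.2)
  have hlim : Tendsto (fun z => (A z).det) (𝓝[angle x 1 ∩ {z | HolAt A z}] (x : ℂ)) (𝓝 L.det) :=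
    (continuous_id.matrix_det.tendsto L).comp (hL 1 one_pos)
  have hL0 : L.det = 0 := by
    refine tendsto_nhds_unique hlim (tendsto_const_nhds.congr' ?_)
    filter_upwards [self_mem_nhdsWithin] with z hz
    exact (hzero z hz.1.1 hz.2).symm
  have h1 := congrArg Matrix.det hLJ
  rw [Matrix.det_mul, hL0, mul_zero] at h1
  have h2 := congrArg Matrix.det (scriptJ_mul_self (n := n))
  rw [Matrix.det_mul, ← h1, mul_zero, Matrix.det_one] at h2
  exact zero_ne_one h2

lemma eventually_sharp_continued (hA : A ∈ classU (scriptJ n)) :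
    ∀ᶠ z in codiscreteWithin upperPlane,
      sharp (matU (continued (scriptJ n) A)) z * scriptJ n * matU A z = smallJ n ∧
        IsUnit (matU A z).toBlocks₁₂ := by
  filter_upwards [eventually_isUnit hA, hA.1.1.eventually_holAt, eventually_matU_posSemidef hA.1]
    with z h1 h2 h3
  exact ⟨sharp_continued_mul h2.1 h1, isUnit_toBlocks₁₂ h3⟩

lemma sharp_u11 (B : ℂ → Matrix (Fin n ⊕ Fin n) (Fin n ⊕ Fin n) ℂ) (z : ℂ) :
    sharp (u11 B) z = (sharp (matU B) z).toBlocks₁₁ := rfl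

lemma sharp_u12 (B : ℂ → Matrix (Fin n ⊕ Fin n) (Fin n ⊕ Fin n) ℂ) (z : ℂ) :
    sharp (u12 B) z = (sharp (matU B) z).toBlocks₂₁ := rfl

lemma tendsto_inv_mul {X : Type*} {l : Filter X} {F : X → Matrix (Fin n ⊕ Fin n) (Fin n ⊕ Fin n) ℂ}
    {Y : Matrix (Fin n ⊕ Fin n) (Fin n ⊕ Fin n) ℂ} (hF : Tendsto F l (𝓝 Y))
    (hY : IsUnit Y.toBlocks₁₂) :
    Tendsto (fun z => (F z).toBlocks₁₂⁻¹ * (F z).toBlocks₁₁) l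
      (𝓝 (Y.toBlocks₁₂⁻¹ * Y.toBlocks₁₁)) := by
  have h12 : Tendsto (fun z => (F z).toBlocks₁₂) l (𝓝 Y.toBlocks₁₂) :=
    ((continuous_id.matrix_submatrix Sum.inl Sum.inr).tendsto Y).comp hF
  have h11 : Tendsto (fun z => (F z).toBlocks₁₁) l (𝓝 Y.toBlocks₁₁) :=
    ((continuous_id.matrix_submatrix Sum.inl Sum.inl).tendsto Y).comp hF
  refine Tendsto.mul ?_ h11
  simp only [Matrix.inv_def, Ring.inverse_eq_inv']
  exact (((continuous_id.matrix_det.tendsto _).comp h12).inv₀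
    ((Matrix.isUnit_iff_isUnit_det _).1 hY).ne_zero).smul
    ((continuous_id.matrix_adjugate.tendsto _).comp h12)

lemma exists_inner (hA : A ∈ classU (scriptJ n)) :
    BelongsTo (fun z => (u12 A z)⁻¹ * u11 A z) (innerClass n) := by
  obtain ⟨χ, hχ, heq⟩ := exists_schur hA.1
  refine ⟨χ, ⟨hχ, ?_⟩, heq⟩
  filter_upwards [hA.2] with x ⟨L, hL, hLJ⟩
  have hY : (L * matM n)ᴴ * scriptJ n * (L * matM n) = smallJ n := by
    calc _ = (matM n)ᴴ * (Lᴴ * scriptJ n * L) * matM n := by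
          simp only [Matrix.conjTranspose_mul, Matrix.mul_assoc]
      _ = _ := by rw [hLJ, matM_conj_scriptJ]
  have hunit : IsUnit (L * matM n).toBlocks₁₂ :=
    isUnit_toBlocks₁₂ (by rw [hY, sub_self]; exact .zero)
  -- The limit of `A` is known only through its holomorphy points, and `χ` is given by the blocks
  -- only off a discrete set; `S` meets both conditions.
  refine ⟨_, hχ.1.hasBoundaryValue
    (S := {z | HolAt A z ∧ (u12 A z)⁻¹ * u11 A z = χ z}) ?_ fun α hα => ?_,
    inv_mul_mul_conjTranspose_eq_one hY⟩
  · filter_upwards [heq, hA.1.1.eventually_holAt] with z h1 h2 using ⟨h2.2, h1⟩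
  · have h1 : Tendsto (matU A) (𝓝[angle x α ∩ {z | HolAt A z}] (x : ℂ)) (𝓝 (L * matM n)) :=
      (hL α hα).mul tendsto_const_nhds
    have h2 := (tendsto_inv_mul h1 hunit).mono_left (nhdsWithin_mono (x : ℂ)
      (Set.inter_subset_inter_right (angle x α)
        (fun z hz => hz.1 : {z | HolAt A z ∧ (u12 A z)⁻¹ * u11 A z = χ z} ⊆ {z | HolAt A z})))
    refine h2.congr' ?_
    filter_upwards [self_mem_nhdsWithin] with z hz using hz.2.2

end ClassU

lemma BelongsTo.congr {𝒞 : Set (ℂ → Matrix (Fin n) (Fin n) ℂ)} {g h : ℂ → Matrix (Fin n) (Fin n) ℂ}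
    (hg : BelongsTo g 𝒞) (hgh : g =ᶠ[codiscreteWithin upperPlane] h) : BelongsTo h 𝒞 :=
  let ⟨f, hf, hgf⟩ := hg
  ⟨f, hf, hgh.symm.trans hgf⟩

end DeBranges

theorem mainTheorem6 (n : ℕ) (A : ℂ → Matrix (Fin n ⊕ Fin n) (Fin n ⊕ Fin n) ℂ)
    (hA : A ∈ DeBranges.classP (DeBranges.scriptJ n)) :
    (∀ z ∈ DeBranges.upperPlane, DeBranges.HolAt A z →
      (DeBranges.smallJ n -
        (DeBranges.matU A z)ᴴ * DeBranges.scriptJ n * DeBranges.matU A z).PosSemidef) ∧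
    (∀ z ∈ DeBranges.upperPlane, DeBranges.HolAt A z → IsUnit (DeBranges.u12 A z)) ∧
    DeBranges.BelongsTo
      (fun z => -Complex.I • (DeBranges.u22 A z * (DeBranges.u12 A z)⁻¹))
      (DeBranges.caratheodory n) ∧
    DeBranges.BelongsTo
      (fun z => (DeBranges.u12 A z)⁻¹ * DeBranges.u11 A z)
      (DeBranges.schur n) ∧
    DeBranges.BelongsTo
      (fun z => (DeBranges.rho Complex.I z)⁻¹ • (DeBranges.u12 A z)⁻¹)
      (DeBranges.hardyTwo n) ∧
    (A ∈ DeBranges.classU (DeBranges.scriptJ n) →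
      ∀ B : ℂ → Matrix (Fin n ⊕ Fin n) (Fin n ⊕ Fin n) ℂ,
      B = DeBranges.continued (DeBranges.scriptJ n) A →
      (∀ᶠ z in codiscreteWithin DeBranges.upperPlane,
        IsUnit (DeBranges.sharp (DeBranges.u11 B) z)) ∧
      (∀ᶠ z in codiscreteWithin DeBranges.upperPlane,
        (DeBranges.u12 A z)⁻¹ * DeBranges.u11 A z =
          DeBranges.sharp (DeBranges.u12 B) z * (DeBranges.sharp (DeBranges.u11 B) z)⁻¹) ∧
      DeBranges.BelongsTo
        (fun z => DeBranges.sharp (DeBranges.u12 B) z * (DeBranges.sharp (DeBranges.u11 B) z)⁻¹)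
        (DeBranges.innerClass n) ∧
      DeBranges.BelongsTo
        (fun z => (DeBranges.rho Complex.I z)⁻¹ •
          (-Complex.I • (DeBranges.sharp (DeBranges.u11 B) z)⁻¹))
        (DeBranges.hardyTwo n)) := by
  refine ⟨fun z hz hhol => DeBranges.matU_posSemidef (hA.2 z hz hhol), fun z hz hhol =>
    DeBranges.isUnit_toBlocks₁₂ (DeBranges.matU_posSemidef (hA.2 z hz hhol)),
    DeBranges.exists_caratheodory hA, DeBranges.exists_schur hA,
    DeBranges.inv_u12_belongsTo_hardyTwo hA, ?_⟩
  rintro hAU B rfl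
  have hdual := DeBranges.eventually_sharp_continued hAU
  have hχ : ∀ᶠ z in codiscreteWithin DeBranges.upperPlane,
      (DeBranges.u12 A z)⁻¹ * DeBranges.u11 A z =
        DeBranges.sharp (DeBranges.u12 (DeBranges.continued (DeBranges.scriptJ n) A)) z *
          (DeBranges.sharp (DeBranges.u11 (DeBranges.continued (DeBranges.scriptJ n) A)) z)⁻¹ := by
    filter_upwards [hdual] with z hz
    rw [DeBranges.sharp_u11, DeBranges.sharp_u12]
    exact DeBranges.inv_mul_eq_mul_inv_dual hz.1 hz.2
  refine ⟨?_, hχ, (DeBranges.exists_inner hAU).congr hχ,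
    (DeBranges.schurComplement_belongsTo_hardyTwo hA).congr ?_⟩
  · filter_upwards [hdual] with z hz
    rw [DeBranges.sharp_u11]
    exact DeBranges.isUnit_dual_toBlocks₁₁ hz.1 hz.2
  · filter_upwards [hdual] with z hz
    rw [DeBranges.sharp_u11, DeBranges.dual_toBlocks₁₁_inv hz.1 hz.2]
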